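/- Let $n\ge 1$. A deterministic line search problem is a deterministic Markov decision process $\phi$ with states $s_1,\dots,s_{n+1}$ and actions $a_1,a_2$, where only $a_1$ is available in $s_1$, only $a_2$ in $s_{n+1}$, and both in the other states; for $1\le i\le n$, the action $a_1$ leads from $s_i$ to $s_{i+1}$ and $a_2$ leads from $s_{i+1}$ to $s_i$. A random reward is received at each available pair $(s,a)$; its distribution belongs to a given one-parameter exponential family $\{e^{\theta x-b_{sa}(\theta)}\lambda_{sa}(dx):\theta\in\mathbb R\}$ on $[0,1]$ ($\lambda_{sa}$ a non-zero finite measure on $[0,1]$, $b_{sa}$ the log-normalizer), and $r_\phi(s,a)$ denotes its mean. For means $m,m'$ let $\mathrm{KL}_{sa}(m,m')$ be the Kullback--Leibler divergence between the members of the family at $(s,a)$ with means $m$ and $m'$, with $\mathrm{KL}_{sa}(m,m')=\infty$ if no member has mean $m'$. A policy $\pi$ chooses, at each time, a (possibly randomized) available action based on the past states, actions and rewards and the current state. Let $V_T^\pi(\phi,s)=\mathbb E^\pi_{\phi|s}\big[\sum_{t=1}^T r_\phi(s_t,a_t)\big]$ for the process started in $s$, let $R_T^\pi(\phi,s)=\sup_{\pi'}V_T^{\pi'}(\phi,s)-V_T^\pi(\phi,s)$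 be the regret, let $N_T(s,a)$ be the number of visits of $(s,a)$ up to time $T$, and let $g^\star_\phi$ be the maximal gain (long-run average reward) of stationary deterministic policies, which for a communicating process does not depend on the initial state. A cycle means a simple cycle, its gain $g_\phi(C)$ is the average of $r_\phi$ over its state-action pairs, and it is optimal if its gain is $g^\star_\phi$. Let $\Phi_D$ be a class of deterministic Markov decision processes with these states, available actions and reward families that contains all line search problems (for instance the class of all such processes, or that of the line search problems only). A policy $\pi$ is uniformly good if $\mathbb E^\pi_{\phi|s}[N_T(s',a)]=o(T^\alpha)$ as $T\to\infty$ for every communicating $\phi\in\Phi_D$, every initial state $s$, every $\alpha>0$, and every available pair $(s',a)$ that does not lie on an optimal cycle of $\phi$. Let $C_i=((s_i,a_1),(s_{i+1},a_2))$ for $1\le i\le n$, so that $g_\phi(C_i)=\tfrac12\big(r_\phi(s_i,a_1)+r_\phi(s_{i+1},a_2)\big)$, and $$I(C_i)=\mathrm{KL}_{s_i a_1}\big(r_\phi(s_i,a_1),\,g^\star_\phi+g_\phi(C_i)-r_\phi(s_{i+1},a_2)\big)+\mathrm{KL}_{s_{i+1}a_2}\big(r_\phi(s_{i+1},a_2),\,g^\star_\phi+g_\phi(C_i)-r_\phi(s_i,a_1)\big).$$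 Then for every uniformly good policy $\pi$, every deterministic line search problem $\phi$ and every initial state $s$, $$\liminf_{T\to\infty}\frac{R^\pi_T(\phi,s)}{\log T}\ \ge\ \sum_{i=1}^n\frac{2\,(g^\star_\phi-g_\phi(C_i))}{I(C_i)},$$ where a summand is read as $0$ if $g_\phi(C_i)=g^\star_\phi$ or $I(C_i)=\infty$. -/

import Mathlib

open MeasureTheory ProbabilityTheory Filter Topology Asymptotics
open scoped ENNReal

/-! ### One-parameter exponential families of rewards in `[0, 1]` -/

/-- A (canonical) one-parameter exponential family of distributions on `[0, 1]`, given by its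
base measure: the members are `exp (θ x - b θ) base(dx)`, `θ : ℝ`, where `b` is the logarithm of
the normalising constant. -/
structure ExpFamily where
  base : Measure ℝ
  finite_base : IsFiniteMeasure base
  base_ne_zero : base ≠ 0
  base_compl : base (Set.Icc (0 : ℝ) 1)ᶜ = 0

namespace ExpFamily

/-- The member of the family with natural parameter `θ`. -/
noncomputable def dist (F : ExpFamily) (θ : ℝ) : Measure ℝ :=
  F.base.tilted (fun x => θ * x)

/-- The mean of the member with natural parameter `θ`. -/
noncomputable def mean (F : ExpFamily) (θ : ℝ) : ℝ :=
  ∫ x, x ∂(F.dist θ)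

/-- `KL(m, m')`: the Kullback-Leibler divergence of the member with mean `m` from the member with
mean `m'`. A member of the family is determined by its mean, so the infimum runs over
a single value; it is `∞` if there is no member with mean `m'`. -/
noncomputable def kl (F : ExpFamily) (m m' : ℝ) : ℝ≥0∞ :=
  ⨅ (θ : ℝ) (θ' : ℝ) (_ : F.mean θ = m) (_ : F.mean θ' = m'),
    InformationTheory.klDiv (F.dist θ) (F.dist θ')

end ExpFamily

/-! ### Deterministic Markov decision processes -/

/-- A deterministic MDP with state space `S`, action space `A`, sets `act s` of actions available
in the state `s`, and rewards at `(s, a)` from the exponential family `F s a`. The values of `next`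
and `param` at pairs `(s, a)` with `a ∉ act s` play no role. -/
structure DMDP (S A : Type) (act : S → Finset A) (F : S → A → ExpFamily) where
  /-- the state that follows when `a` is chosen in `s` -/
  next : S → A → S
  /-- the natural parameter of the reward distribution at `(s, a)` -/
  param : S → A → ℝ

/-- A policy: at time `t`, given the past triples (state, action, reward) and the current state,
a distribution on the actions that are available in the current state. -/
structure Policy (S A : Type) [MeasurableSpace S] [MeasurableSpace A] (act : S → Finset A) where
  choice : (t : ℕ) → Kernel ((Fin t → (S × A) × ℝ) × S) A
  isMarkov : ∀ t, IsMarkovKernel (choice t)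
  available : ∀ t h s, ∀ a ∉ act s, choice t (h, s) {a} = 0

namespace DMDP

variable {S A : Type} {act : S → Finset A} {F : S → A → ExpFamily}

/-- The reward distribution `q(· | s, a)`. -/
noncomputable def rewardDist (φ : DMDP S A act F) (s : S) (a : A) : Measure ℝ :=
  (F s a).dist (φ.param s a)

/-- The mean reward `r(s, a)`. -/
noncomputable def r (φ : DMDP S A act F) (s : S) (a : A) : ℝ :=
  (F s a).mean (φ.param s a)

/-- The state at time `t`, as a function of the history before time `t`. -/
def current (φ : DMDP S A act F) (s₁ : S) : (t : ℕ) → (Fin t → (S × A) × ℝ) → S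
  | 0, _ => s₁
  | t + 1, h => φ.next (h (Fin.last t)).1.1 (h (Fin.last t)).1.2

section Law

variable [Finite S] [Finite A] [MeasurableSpace S] [MeasurableSpace A]
  [MeasurableSingletonClass S] [MeasurableSingletonClass A]

theorem measurable_current (φ : DMDP S A act F) (s₁ : S) (t : ℕ) :
    Measurable (φ.current s₁ t) := by
  cases t with
  | zero => exact measurable_const
  | succ t =>
    exact (measurable_of_countable (fun e : S × A => φ.next e.1 e.2)).comp
      (measurable_fst.comp (measurable_pi_apply (Fin.last t)))

/-- The reward distributions, as a kernel. -/
noncomputable def rewardKernel (φ : DMDP S A act F) : Kernel (S × A) ℝ :=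
  Kernel.ofFunOfCountable (fun e => φ.rewardDist e.1 e.2)

/-- The conditional law of (state, action, reward) at time `t` given the history before `t`. -/
noncomputable def step (φ : DMDP S A act F) (π : Policy S A act) (s₁ : S) (t : ℕ) :
    Kernel (Fin t → (S × A) × ℝ) ((S × A) × ℝ) :=
  ((Kernel.deterministic (φ.current s₁ t) (φ.measurable_current s₁ t)) ⊗ₖ (π.choice t)) ⊗ₖ
    (Kernel.prodMkLeft (Fin t → (S × A) × ℝ) φ.rewardKernel)

/-- The law of the first `T` triples (state, action, reward) under the policy `π`, when the initial
state is `s₁`. -/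
noncomputable def law (φ : DMDP S A act F) (π : Policy S A act) (s₁ : S) :
    (T : ℕ) → Measure (Fin T → (S × A) × ℝ)
  | 0 => Measure.dirac Fin.elim0
  | T + 1 => ((law φ π s₁ T) ⊗ₘ (φ.step π s₁ T)).map
      (fun p => Fin.snoc (α := fun _ => (S × A) × ℝ) p.1 p.2)

/-- The expected cumulative reward `V_T^π(s₁)`. -/
noncomputable def value (φ : DMDP S A act F) (π : Policy S A act) (s₁ : S) (T : ℕ) : ℝ :=
  ∫ h, ∑ t : Fin T, φ.r (h t).1.1 (h t).1.2 ∂(φ.law π s₁ T)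

/-- The regret `R_T^π(s₁)`: the supremum of the value over all policies, minus the value of `π`. -/
noncomputable def regret (φ : DMDP S A act F) (π : Policy S A act) (s₁ : S) (T : ℕ) : ℝ :=
  (⨆ π' : Policy S A act, φ.value π' s₁ T) - φ.value π s₁ T

open Classical in
/-- `E[N_T(s, a)]`, the expected number of visits of the pair `(s, a)` up to time `T`. -/
noncomputable def expVisits (φ : DMDP S A act F) (π : Policy S A act) (s₁ : S) (T : ℕ)
    (s : S) (a : A) : ℝ :=
  ∫ h, ((Finset.univ.filter (fun t : Fin T => (h t).1 = (s, a))).card : ℝ) ∂(φ.law π s₁ T)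

end Law

/-- The stationary, deterministic, Markov policies. -/
abbrev Stationary (S A : Type) (act : S → Finset A) : Type :=
  {f : S → A // ∀ s, f s ∈ act s}

/-- The state that is reached from `s` after `t` steps of the stationary policy `f`. -/
def orbit (φ : DMDP S A act F) (f : Stationary S A act) (s : S) (t : ℕ) : S :=
  (fun x => φ.next x (f.1 x))^[t] s

/-- Every state is accessible from every state. -/
def Communicating (φ : DMDP S A act F) : Prop :=
  ∀ s s' : S, ∃ f : Stationary S A act, ∃ t : ℕ, φ.orbit f s t = s'

/-- The gain of a stationary policy: the limit of its average reward
(the limit exists, since the orbit is eventually periodic). -/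
noncomputable def gain (φ : DMDP S A act F) (f : Stationary S A act) (s : S) : ℝ :=
  limUnder atTop (fun T : ℕ =>
    (∑ t ∈ Finset.range T, φ.r (φ.orbit f s t) (f.1 (φ.orbit f s t))) / (T : ℝ))

/-- The maximal gain `g⋆` (which does not depend on `s` if the DMDP is communicating). -/
noncomputable def optGain (φ : DMDP S A act F) (s : S) : ℝ :=
  ⨆ f : Stationary S A act, φ.gain f s

/-- A simple cycle: a non-empty walk, made of available state-action pairs, without repeated
vertices, whose final edge leads to its initial vertex. -/
def IsSimpleCycle (φ : DMDP S A act F) (C : List (S × A)) : Prop :=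
  (∀ e ∈ C, e.2 ∈ act e.1) ∧
  C.IsChain (fun e e' => φ.next e.1 e.2 = e'.1) ∧
  (C.map Prod.fst).Nodup ∧
  ∃ h : C ≠ [], φ.next (C.getLast h).1 (C.getLast h).2 = (C.head h).1

/-- The gain of a cycle: its average reward. -/
noncomputable def cycleGain (φ : DMDP S A act F) (C : List (S × A)) : ℝ :=
  (C.map (fun e => φ.r e.1 e.2)).sum / (C.length : ℝ)

/-- `(s, a) ∈ C⋆`: the pair lies on an optimal cycle, i.e. on a simple cycle whose gain is
the maximal gain. (If there is exactly one optimal cycle, these are its pairs.) -/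
def OnOptimalCycle (φ : DMDP S A act F) (s : S) (a : A) : Prop :=
  ∃ C : List (S × A), φ.IsSimpleCycle C ∧ (∀ x, φ.cycleGain C = φ.optGain x) ∧ (s, a) ∈ C

end DMDP

/-- The policy `π` is uniformly good on the class `Φ` of DMDPs: for every communicating DMDP of
the class, every initial state and every `α > 0`, every state-action pair that is not part of
an optimal cycle is visited `o(T ^ α)` times in expectation. -/
def UniformlyGood {S A : Type} {act : S → Finset A} {F : S → A → ExpFamily}
    [Finite S] [Finite A] [MeasurableSpace S] [MeasurableSpace A]
    [MeasurableSingletonClass S] [MeasurableSingletonClass A]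
    (Φ : Set (DMDP S A act F)) (π : Policy S A act) : Prop :=
  ∀ φ ∈ Φ, φ.Communicating → ∀ s₁ : S, ∀ α : ℝ, 0 < α →
    ∀ s : S, ∀ a ∈ act s, ¬ φ.OnOptimalCycle s a →
      (fun T : ℕ => φ.expVisits π s₁ T s a) =o[atTop] (fun T : ℕ => (T : ℝ) ^ α)

/-! ### Deterministic line search -/

/-- The available actions of the line with the states `0, …, n`; the actions `0` and `1`
stand for `a₁` (one step to the right) and `a₂` (one step to the left). At the left end only
`a₁` is available, at the right end only `a₂`, and in between both. -/
def lineAct (n : ℕ) (s : Fin (n + 1)) : Finset (Fin 2) :=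
  Finset.univ.filter (fun a => (a = 0 → s ≠ Fin.last n) ∧ (a = 1 → s ≠ 0))

namespace DMDP

variable {n : ℕ} {F : Fin (n + 1) → Fin 2 → ExpFamily}

/-- A deterministic line search problem: `a₁` leads from `sᵢ` to `sᵢ₊₁`, and `a₂` leads from
`sᵢ₊₁` to `sᵢ`. -/
def IsLineSearch (φ : DMDP (Fin (n + 1)) (Fin 2) (lineAct n) F) : Prop :=
  ∀ i : Fin n, φ.next i.castSucc 0 = i.succ ∧ φ.next i.succ 1 = i.castSucc

/-- The cycle `Cᵢ = ((sᵢ, a₁), (sᵢ₊₁, a₂))`. -/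
def lineCycle (i : Fin n) : List (Fin (n + 1) × Fin 2) :=
  [(i.castSucc, 0), (i.succ, 1)]

/-- The information number `I(Cᵢ)`, where `g` is the maximal gain. -/
noncomputable def lineInfo (φ : DMDP (Fin (n + 1)) (Fin 2) (lineAct n) F) (g : ℝ) (i : Fin n) :
    ℝ≥0∞ :=
  (F i.castSucc 0).kl (φ.r i.castSucc 0) (g + φ.cycleGain (lineCycle i) - φ.r i.succ 1) +
    (F i.succ 1).kl (φ.r i.succ 1) (g + φ.cycleGain (lineCycle i) - φ.r i.castSucc 0)

end DMDP

/-! Every available pair of the line lies on exactly one `lineCycle i`, and its reward is the gain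
of that cycle plus a potential difference (`IsLineSearch.r_eq`). Potentials telescope, so up to a
bounded error the value counts visits to the cycles weighted by their gains, and the regret is at
least the sum of gap times expected time on each cycle (`IsLineSearch.exists_le_regret`). It remains
to show that a suboptimal cycle takes at least about `2 log T / I` steps.

This is a change of measure in the manner of Lai and Robbins. The two target means in `lineInfo` add
up to twice the optimal gain, so giving them to the two pairs of the cycle makes it exactly optimal;
a further small shift of one parameter makes it the only optimal cycle of a line search problem `φ'`
(`IsLineSearch.exists_alternative`). Uniform goodness leaves almost no time on the cycle under `φ`
and almost no time off it under `φ'`. Telling the two apart costs information: the Gibbs inequality,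
applied to a multiple `l` of the fraction `W` of time off the cycle, gives `l E W ≤ KL + exp l E' W`
(`mul_expSum_le`). With `l` slightly below `log T` the last term vanishes, so the divergence of the
two laws is at least about `log T`.

That divergence is the sum, over the two pairs, of expected visits times reward divergence
(`integral_histLogRatio`). On a line the rightward and leftward crossings of an edge alternate
(`IsLineSearch.abs_expSum_pairInd_sub_le`), so each pair receives half the time spent on the cycle,
up to a constant; this is the origin of the factor 2. -/

/-! ### Exponential families -/

namespace ExpFamily

variable (F : ExpFamily)

instance instIsFiniteMeasureBase : IsFiniteMeasure F.base := F.finite_base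

instance instNeZeroBase : NeZero F.base := ⟨F.base_ne_zero⟩

theorem ae_base_mem : ∀ᵐ x ∂F.base, x ∈ Set.Icc (0 : ℝ) 1 := F.base_compl

theorem integrable_exp_mul (θ : ℝ) : Integrable (fun x => Real.exp (θ * x)) F.base := by
  refine Integrable.of_bound (by fun_prop) (Real.exp |θ|) ?_
  filter_upwards [F.ae_base_mem] with x hx
  rw [Real.norm_eq_abs, Real.abs_exp]
  refine Real.exp_le_exp.2 ((le_abs_self _).trans ?_)
  rw [abs_mul, abs_of_nonneg hx.1]
  exact mul_le_of_le_one_right (abs_nonneg _) hx.2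

instance instIsProbabilityMeasureDist (θ : ℝ) : IsProbabilityMeasure (F.dist θ) :=
  isProbabilityMeasure_tilted (F.integrable_exp_mul θ)

theorem ae_dist_mem (θ : ℝ) : ∀ᵐ x ∂F.dist θ, x ∈ Set.Icc (0 : ℝ) 1 :=
  (tilted_absolutelyContinuous F.base _).ae_le F.ae_base_mem

theorem integrable_id_dist (θ : ℝ) : Integrable (fun x : ℝ => x) (F.dist θ) := by
  refine Integrable.of_bound (by fun_prop) 1 ?_
  filter_upwards [F.ae_dist_mem θ] with x hx
  rw [Real.norm_eq_abs, abs_of_nonneg hx.1]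
  exact hx.2

theorem mean_nonneg (θ : ℝ) : 0 ≤ F.mean θ := by
  refine integral_nonneg_of_ae ?_
  filter_upwards [F.ae_dist_mem θ] with x hx using hx.1

theorem mean_le_one (θ : ℝ) : F.mean θ ≤ 1 := by
  have h : F.mean θ ≤ ∫ _, (1 : ℝ) ∂F.dist θ := by
    refine integral_mono_ae (F.integrable_id_dist θ) (integrable_const _) ?_
    filter_upwards [F.ae_dist_mem θ] with x hx using hx.2
  simpa using h

/-- The log-normaliser. -/
noncomputable def logNorm (θ : ℝ) : ℝ := Real.log (∫ x, Real.exp (θ * x) ∂F.base)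

theorem integral_exp_mul_pos (θ : ℝ) : 0 < ∫ x, Real.exp (θ * x) ∂F.base :=
  integral_exp_pos (F.integrable_exp_mul θ)

/-- The logarithm of the density of the member `θ` with respect to the member `θ'`. -/
noncomputable def logRatio (θ θ' x : ℝ) : ℝ := (θ - θ') * x + (F.logNorm θ' - F.logNorm θ)

/-- The Kullback-Leibler divergence in closed form. -/
noncomputable def div (θ θ' : ℝ) : ℝ := (θ - θ') * F.mean θ + (F.logNorm θ' - F.logNorm θ)

theorem measurable_logRatio (θ θ' : ℝ) : Measurable (F.logRatio θ θ') := by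
  unfold logRatio; fun_prop

theorem dist_eq_tilted (θ θ' : ℝ) :
    F.dist θ' = (F.dist θ).tilted (fun x => (θ' - θ) * x) := by
  unfold dist
  rw [tilted_tilted (F.integrable_exp_mul θ)]
  congr 1; ext x; simp only [Pi.add_apply]; ring

theorem integrable_exp_mul_dist (θ t : ℝ) : Integrable (fun x => Real.exp (t * x)) (F.dist θ) := by
  refine Integrable.of_bound (by fun_prop) (Real.exp |t|) ?_
  filter_upwards [F.ae_dist_mem θ] with x hx
  rw [Real.norm_eq_abs, Real.abs_exp]
  refine Real.exp_le_exp.2 ((le_abs_self _).trans ?_)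
  rw [abs_mul, abs_of_nonneg hx.1]
  exact mul_le_of_le_one_right (abs_nonneg _) hx.2

theorem integral_exp_mul_dist (θ θ' : ℝ) :
    ∫ x, Real.exp ((θ' - θ) * x) ∂F.dist θ = Real.exp (F.logNorm θ' - F.logNorm θ) := by
  unfold dist
  rw [integral_exp_tilted, Real.exp_sub, logNorm, logNorm, Real.exp_log (F.integral_exp_mul_pos _),
    Real.exp_log (F.integral_exp_mul_pos _)]
  congr 2; ext x; simp only [Pi.add_apply]; congr 1; ring

theorem dist_eq_withDensity (θ θ' : ℝ) :
    F.dist θ' = (F.dist θ).withDensity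
      (fun x => ENNReal.ofReal (Real.exp (-F.logRatio θ θ' x))) := by
  conv_lhs => rw [F.dist_eq_tilted θ θ']
  unfold Measure.tilted
  rw [integral_exp_mul_dist]
  congr 1; ext x
  rw [← Real.exp_sub]
  unfold logRatio
  congr 2; ring

theorem integral_logRatio (θ θ' : ℝ) : ∫ x, F.logRatio θ θ' x ∂F.dist θ = F.div θ θ' := by
  unfold logRatio div mean
  rw [integral_add ((F.integrable_id_dist θ).const_mul _) (integrable_const _),
    integral_const_mul]
  simp

theorem dist_absolutelyContinuous (θ θ' : ℝ) : F.dist θ ≪ F.dist θ' := by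
  rw [F.dist_eq_tilted θ' θ]
  exact tilted_absolutelyContinuous _ _

theorem integrable_llr_dist (θ θ' : ℝ) :
    Integrable (llr (F.dist θ) (F.dist θ')) (F.dist θ) := by
  rw [F.dist_eq_tilted θ θ']
  refine integrable_llr_tilted_right Measure.AbsolutelyContinuous.rfl
    ((F.integrable_id_dist θ).const_mul _) ?_ (F.integrable_exp_mul_dist _ _)
  exact (integrable_congr (llr_self _)).2 (integrable_zero _ _ _)

theorem toReal_klDiv_dist (θ θ' : ℝ) :
    (InformationTheory.klDiv (F.dist θ) (F.dist θ')).toReal = F.div θ θ' := by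
  rw [InformationTheory.toReal_klDiv_of_measure_eq (F.dist_absolutelyContinuous _ _) (by simp),
    F.dist_eq_tilted θ θ', integral_llr_tilted_right Measure.AbsolutelyContinuous.rfl
    ((F.integrable_id_dist θ).const_mul _) (F.integrable_exp_mul_dist _ _)
    ((integrable_congr (llr_self _)).2 (integrable_zero _ _ _)), integral_congr_ae (llr_self _),
    integral_exp_mul_dist, Real.log_exp, integral_const_mul]
  simp only [Pi.zero_apply, integral_zero, div, mean]
  ring

theorem klDiv_dist_ne_top (θ θ' : ℝ) :
    InformationTheory.klDiv (F.dist θ) (F.dist θ') ≠ ∞ :=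
  InformationTheory.klDiv_ne_top (F.dist_absolutelyContinuous _ _) (F.integrable_llr_dist _ _)

theorem klDiv_dist (θ θ' : ℝ) :
    InformationTheory.klDiv (F.dist θ) (F.dist θ') = ENNReal.ofReal (F.div θ θ') := by
  rw [← toReal_klDiv_dist, ENNReal.ofReal_toReal (F.klDiv_dist_ne_top _ _)]

theorem div_nonneg (θ θ' : ℝ) : 0 ≤ F.div θ θ' := by
  rw [← toReal_klDiv_dist]; exact ENNReal.toReal_nonneg

theorem div_self (θ : ℝ) : F.div θ θ = 0 := by simp [div]

theorem dist_eq_of_div_eq_zero {θ θ' : ℝ} (h : F.div θ θ' = 0) : F.dist θ = F.dist θ' := by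
  rw [← InformationTheory.klDiv_eq_zero_iff, klDiv_dist, h, ENNReal.ofReal_zero]

theorem div_add_div (θ θ' : ℝ) :
    F.div θ θ' + F.div θ' θ = (θ - θ') * (F.mean θ - F.mean θ') := by
  unfold div; ring

/-- The symmetrised divergence in `div_add_div` is nonnegative, so parameters and means are ordered
alike. -/
theorem mean_mono : Monotone F.mean := by
  intro θ θ' h
  have h1 := F.div_add_div θ θ'
  have h2 := F.div_nonneg θ θ'
  have h3 := F.div_nonneg θ' θ
  rcases h.eq_or_lt with rfl | h
  · exact le_rfl
  · nlinarith

/-- A member of the family is determined by its mean. -/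
theorem dist_eq_of_mean_eq {θ θ' : ℝ} (h : F.mean θ = F.mean θ') : F.dist θ = F.dist θ' := by
  have h1 := F.div_add_div θ θ'
  have h2 := F.div_nonneg θ θ'
  have h3 := F.div_nonneg θ' θ
  -- Equal means annihilate the symmetrised divergence, hence both of its nonnegative terms.
  rw [h, sub_self, mul_zero] at h1
  exact F.dist_eq_of_div_eq_zero (by linarith)

theorem kl_mean_mean (θ θ' : ℝ) : F.kl (F.mean θ) (F.mean θ') = ENNReal.ofReal (F.div θ θ') := by
  refine le_antisymm ?_ ?_
  · rw [← klDiv_dist]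
    exact iInf₂_le_of_le θ θ' (iInf_le_of_le rfl (iInf_le_of_le rfl le_rfl))
  · refine le_iInf₂ fun η η' => le_iInf₂ fun h h' => ?_
    rw [F.dist_eq_of_mean_eq h, F.dist_eq_of_mean_eq h', klDiv_dist]

theorem exists_mean_eq_of_kl_ne_top {m m' : ℝ} (h : F.kl m m' ≠ ∞) : ∃ θ, F.mean θ = m' := by
  by_contra! h'
  refine h ?_
  simp only [kl, h', iInf_false, iInf_top]

/-- If the mean is not constant, it increases strictly. -/
theorem mean_lt_mean_add {θ₀ θ ε : ℝ} (h : F.mean θ₀ ≠ F.mean θ) (hε : 0 < ε) :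
    F.mean θ < F.mean (θ + ε) := by
  refine lt_of_le_of_ne (F.mean_mono (by linarith)) fun heq => h ?_
  have h1 := F.dist_eq_of_mean_eq heq
  have h2 := F.dist_eq_withDensity θ (θ + ε)
  rw [← h1] at h2
  -- A density equal to 1 has zero logarithm, which is affine in `x` with nonzero slope. So the law
  -- sits at a single point, as do all members of the family, and the mean is constant.
  have h3 : (fun x => ENNReal.ofReal (Real.exp (-F.logRatio θ (θ + ε) x))) =ᵐ[F.dist θ] 1 := by
    have := F.measurable_logRatio θ (θ + ε)
    refine (withDensity_eq_iff_of_sigmaFinite (by fun_prop) aemeasurable_one).1 ?_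
    exact h2.symm.trans withDensity_one.symm
  have h4 : ∀ᵐ x ∂F.dist θ, x = (F.logNorm (θ + ε) - F.logNorm θ) / ε := by
    filter_upwards [h3] with x hx
    simp only [Pi.one_apply, ENNReal.ofReal_eq_one, Real.exp_eq_one_iff, logRatio] at hx
    field_simp
    linarith
  have h5 : ∀ η, F.mean η = (F.logNorm (θ + ε) - F.logNorm θ) / ε := by
    intro η
    unfold mean
    rw [integral_congr_ae ((F.dist_absolutelyContinuous η θ).ae_le h4)]
    simp
  rw [h5, h5]

/-- Rewards are at most 1, so `logNorm` grows by at most `ε`; the linear term only decreases because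
the mean is nonnegative. This bounds the price of making the alternative strictly better. -/
theorem div_add_le (θ₀ θ : ℝ) {ε : ℝ} (hε : 0 ≤ ε) : F.div θ₀ (θ + ε) ≤ F.div θ₀ θ + ε := by
  have h : F.logNorm (θ + ε) ≤ ε + F.logNorm θ := by
    unfold logNorm
    rw [← Real.log_exp ε, ← Real.log_mul (Real.exp_pos _).ne' (F.integral_exp_mul_pos _).ne',
      Real.log_exp, ← integral_const_mul]
    refine Real.log_le_log (F.integral_exp_mul_pos _) ?_
    refine integral_mono_ae (F.integrable_exp_mul _) ((F.integrable_exp_mul _).const_mul _) ?_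
    filter_upwards [F.ae_base_mem] with x hx
    rw [← Real.exp_add]
    exact Real.exp_le_exp.2 (by nlinarith [hx.2])
  have := F.mean_nonneg θ₀
  unfold div
  nlinarith

end ExpFamily

/-! ### The law of the process -/

namespace DMDP

variable {S A : Type} {act : S → Finset A} {F : S → A → ExpFamily}

theorem r_nonneg (φ : DMDP S A act F) (s : S) (a : A) : 0 ≤ φ.r s a := (F s a).mean_nonneg _

theorem r_le_one (φ : DMDP S A act F) (s : S) (a : A) : φ.r s a ≤ 1 := (F s a).mean_le_one _

theorem measurable_snoc [MeasurableSpace S] [MeasurableSpace A] (T : ℕ) :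
    Measurable (fun p : (Fin T → (S × A) × ℝ) × ((S × A) × ℝ) =>
      (Fin.snoc (α := fun _ => (S × A) × ℝ) p.1 p.2 : Fin (T + 1) → (S × A) × ℝ)) := by
  refine measurable_pi_iff.2 fun i => ?_
  refine Fin.lastCases ?_ (fun j => ?_) i
  · simpa using measurable_snd
  · simpa using (measurable_pi_apply j).fun_comp measurable_fst

variable [Finite S] [Finite A] [MeasurableSpace S] [MeasurableSpace A]
  [MeasurableSingletonClass S] [MeasurableSingletonClass A]

instance instIsMarkovKernelReward (φ : DMDP S A act F) : IsMarkovKernel φ.rewardKernel :=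
  ⟨fun e => inferInstanceAs (IsProbabilityMeasure ((F e.1 e.2).dist _))⟩

instance instIsMarkovKernelStep (φ : DMDP S A act F) (π : Policy S A act) (s₁ : S) (t : ℕ) :
    IsMarkovKernel (φ.step π s₁ t) := by
  have := π.isMarkov t
  unfold step
  infer_instance

instance instIsProbabilityMeasureLaw (φ : DMDP S A act F) (π : Policy S A act) (s₁ : S) (T : ℕ) :
    IsProbabilityMeasure (φ.law π s₁ T) := by
  induction T with
  | zero => unfold law; infer_instance
  | succ T ih =>
    unfold law
    exact Measure.isProbabilityMeasure_map (measurable_snoc T).aemeasurable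

variable (φ : DMDP S A act F) (π : Policy S A act) (s₁ : S)

/-! ### Integrals and almost sure properties of histories. -/

theorem lintegral_step {t : ℕ} (h : Fin t → (S × A) × ℝ) {f : (S × A) × ℝ → ℝ≥0∞}
    (hf : Measurable f) :
    ∫⁻ y, f y ∂φ.step π s₁ t h =
      ∫⁻ a, ∫⁻ x, f ((φ.current s₁ t h, a), x) ∂φ.rewardDist (φ.current s₁ t h) a
        ∂π.choice t (h, φ.current s₁ t h) := by
  have := π.isMarkov t
  unfold step
  rw [Kernel.lintegral_compProd _ _ _ hf, Kernel.lintegral_compProd, Kernel.lintegral_deterministic']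
  · rfl
  · exact measurable_of_countable _
  · exact measurable_of_countable _

theorem lintegral_law_succ {T : ℕ} {f : (Fin (T + 1) → (S × A) × ℝ) → ℝ≥0∞} (hf : Measurable f) :
    ∫⁻ h, f h ∂φ.law π s₁ (T + 1) =
      ∫⁻ h, ∫⁻ y, f (Fin.snoc (α := fun _ => (S × A) × ℝ) h y) ∂φ.step π s₁ T h
        ∂φ.law π s₁ T := by
  rw [law, lintegral_map hf (measurable_snoc T)]
  exact Measure.lintegral_compProd (hf.comp (measurable_snoc T))

theorem integral_law_succ {T : ℕ} {f : (Fin (T + 1) → (S × A) × ℝ) → ℝ} (hm : Measurable f)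
    (hf : Integrable f (φ.law π s₁ (T + 1))) :
    ∫ h, f h ∂φ.law π s₁ (T + 1) =
      ∫ h, ∫ y, f (Fin.snoc (α := fun _ => (S × A) × ℝ) h y) ∂φ.step π s₁ T h
        ∂φ.law π s₁ T := by
  rw [law] at hf ⊢
  rw [integral_map (measurable_snoc T).aemeasurable hm.aestronglyMeasurable,
    Measure.integral_compProd]
  exact (integrable_map_measure hm.aestronglyMeasurable (measurable_snoc T).aemeasurable).1 hf

/-- The set `K` serves two purposes: it is `act` for a general policy and a singleton for a
stationary deterministic one. -/
theorem ae_step {K : S → Set A} (hK : ∀ t h s, ∀ a ∉ K s, π.choice t (h, s) {a} = 0) {t : ℕ}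
    (h : Fin t → (S × A) × ℝ) :
    ∀ᵐ y ∂φ.step π s₁ t h, y.1.1 = φ.current s₁ t h ∧ y.1.2 ∈ K y.1.1 ∧
      y.2 ∈ Set.Icc (0 : ℝ) 1 := by
  have := π.isMarkov t
  have hKm : MeasurableSet {e : S × A | e.2 ∈ K e.1} := Set.Finite.measurableSet (Set.toFinite _)
  have hm : MeasurableSet {y : (S × A) × ℝ | y.1.1 = φ.current s₁ t h ∧ y.1.2 ∈ K y.1.1 ∧
      y.2 ∈ Set.Icc (0 : ℝ) 1} :=
    (measurable_fst.comp measurable_fst (measurableSet_singleton _)).inter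
      ((measurable_fst hKm).inter (measurable_snd measurableSet_Icc))
  rw [ae_iff, ← Set.compl_ofPred, ← lintegral_indicator_one hm.compl,
    lintegral_step _ _ _ _ (measurable_one.indicator hm.compl)]
  rw [lintegral_eq_zero_iff (measurable_of_countable _)]
  have h1 : ∀ᵐ a ∂π.choice t (h, φ.current s₁ t h), a ∈ K (φ.current s₁ t h) := by
    rw [ae_iff]
    have hc : {a | a ∉ K (φ.current s₁ t h)} = ⋃ a ∈ {a | a ∉ K (φ.current s₁ t h)}, {a} := by
      ext a; simp
    rw [hc]
    exact (measure_biUnion_null_iff (Set.to_countable _)).2 fun a ha => hK t h _ a ha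
  filter_upwards [h1] with a ha
  refine (lintegral_congr_ae ?_).trans lintegral_zero
  filter_upwards [(F _ _).ae_dist_mem _] with x hx
  refine Set.indicator_of_notMem ?_ _
  simp only [Set.mem_compl_iff, Set.mem_ofPred_eq, not_not]
  exact ⟨trivial, ha, hx⟩

/-- Histories are arbitrary sequences of triples; only almost surely is each recorded state the
successor of the preceding pair. That makes the increments of `v` telescope. -/
theorem ae_law {K : S → Set A} (hK : ∀ t h s, ∀ a ∉ K s, π.choice t (h, s) {a} = 0)
    (v : S → ℝ) (T : ℕ) :
    ∀ᵐ h ∂φ.law π s₁ T, (∀ t, (h t).1.2 ∈ K (h t).1.1 ∧ (h t).2 ∈ Set.Icc (0 : ℝ) 1) ∧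
      ∑ t, (v (φ.next (h t).1.1 (h t).1.2) - v (h t).1.1) = v (φ.current s₁ T h) - v s₁ := by
  induction T with
  | zero =>
    refine Eventually.of_forall fun h => ⟨fun t => t.elim0, ?_⟩
    simp [current]
  | succ T ih =>
    have hKm : MeasurableSet {e : S × A | e.2 ∈ K e.1} := Set.Finite.measurableSet (Set.toFinite _)
    have hv : Measurable v := measurable_of_countable _
    have hd : Measurable (fun e : S × A => v (φ.next e.1 e.2) - v e.1) := measurable_of_countable _
    have hm : MeasurableSet {h : Fin (T + 1) → (S × A) × ℝ |
        (∀ t, (h t).1.2 ∈ K (h t).1.1 ∧ (h t).2 ∈ Set.Icc (0 : ℝ) 1) ∧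
        ∑ t, (v (φ.next (h t).1.1 (h t).1.2) - v (h t).1.1) =
          v (φ.current s₁ (T + 1) h) - v s₁} := by
      rw [Set.ofPred_and, Set.ofPred_forall]
      refine MeasurableSet.inter ?_ (measurableSet_eq_fun ?_ ?_)
      · refine MeasurableSet.iInter fun t => MeasurableSet.inter ?_ ?_
        · exact (measurable_fst.comp (measurable_pi_apply t)) hKm
        · exact (measurable_snd.comp (measurable_pi_apply t)) measurableSet_Icc
      · exact Finset.measurable_sum _ fun t _ =>
          hd.comp (measurable_fst.comp (measurable_pi_apply t))
      · exact (hv.comp (φ.measurable_current s₁ (T + 1))).sub_const _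
    rw [law, ae_map_iff (measurable_snoc T).aemeasurable]
    · refine Measure.ae_compProd_of_ae_ae ?_ ?_
      · exact measurable_snoc T hm
      filter_upwards [ih] with h hh
      filter_upwards [φ.ae_step π s₁ hK h] with y hy
      refine ⟨fun t => ?_, ?_⟩
      · refine Fin.lastCases ?_ (fun j => ?_) t
        · simpa using hy.2
        · simpa using hh.1 j
      · rw [Fin.sum_univ_castSucc]
        simp only [Fin.snoc_castSucc, Fin.snoc_last, hh.2, current, hy.1]
        ring
    · exact hm

/-- The expectation of the sum of `c (s_t, a_t)` over the first `T` times. -/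
noncomputable def expSum (T : ℕ) (c : S × A → ℝ) : ℝ :=
  ∫ h, ∑ t : Fin T, c (h t).1 ∂φ.law π s₁ T

theorem measurable_sum (T : ℕ) (c : S × A → ℝ) :
    Measurable (fun h : Fin T → (S × A) × ℝ => ∑ t : Fin T, c (h t).1) := by
  have : Measurable c := measurable_of_countable c
  fun_prop

theorem integrable_sum (T : ℕ) (c : S × A → ℝ) :
    Integrable (fun h : Fin T → (S × A) × ℝ => ∑ t : Fin T, c (h t).1) (φ.law π s₁ T) := by
  have hc : Measurable c := measurable_of_countable c
  refine integrable_finsetSum _ fun t _ => ?_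
  obtain ⟨C, hC⟩ := (Set.finite_range fun e => ‖c e‖).bddAbove
  exact Integrable.of_bound (hc.comp (measurable_fst.comp (measurable_pi_apply t))).aestronglyMeasurable C (Eventually.of_forall fun h => hC ⟨_, rfl⟩)

theorem expSum_add (T : ℕ) (c d : S × A → ℝ) :
    φ.expSum π s₁ T (fun e => c e + d e) = φ.expSum π s₁ T c + φ.expSum π s₁ T d := by
  unfold expSum
  rw [← integral_add (φ.integrable_sum π s₁ T c) (φ.integrable_sum π s₁ T d)]
  simp only [Finset.sum_add_distrib]

theorem expSum_const_mul (T : ℕ) (k : ℝ) (c : S × A → ℝ) :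
    φ.expSum π s₁ T (fun e => k * c e) = k * φ.expSum π s₁ T c := by
  unfold expSum
  simp only [← Finset.mul_sum, integral_const_mul]

theorem expSum_const (T : ℕ) (k : ℝ) : φ.expSum π s₁ T (fun _ => k) = T * k := by
  simp [expSum]

theorem expSum_sum {ι : Type*} (I : Finset ι) (T : ℕ) (c : ι → S × A → ℝ) :
    φ.expSum π s₁ T (fun e => ∑ i ∈ I, c i e) = ∑ i ∈ I, φ.expSum π s₁ T (c i) := by
  unfold expSum
  rw [← integral_finsetSum _ fun i _ => φ.integrable_sum π s₁ T (c i)]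
  congr 1; ext h; exact Finset.sum_comm

theorem expSum_mono_of_support {K : S → Set A}
    (hK : ∀ t h s, ∀ a ∉ K s, π.choice t (h, s) {a} = 0) (T : ℕ) {c d : S × A → ℝ}
    (hcd : ∀ s, ∀ a ∈ K s, c (s, a) ≤ d (s, a)) :
    φ.expSum π s₁ T c ≤ φ.expSum π s₁ T d := by
  refine integral_mono_ae (φ.integrable_sum π s₁ T c) (φ.integrable_sum π s₁ T d) ?_
  filter_upwards [φ.ae_law π s₁ hK 0 T] with h hh
  exact Finset.sum_le_sum fun t _ => hcd _ _ (hh.1 t).1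

theorem expSum_mono (T : ℕ) {c d : S × A → ℝ} (hcd : ∀ s, ∀ a ∈ act s, c (s, a) ≤ d (s, a)) :
    φ.expSum π s₁ T c ≤ φ.expSum π s₁ T d :=
  φ.expSum_mono_of_support π s₁ (K := fun s => act s) π.available T hcd

theorem expSum_congr (T : ℕ) {c d : S × A → ℝ} (hcd : ∀ s, ∀ a ∈ act s, c (s, a) = d (s, a)) :
    φ.expSum π s₁ T c = φ.expSum π s₁ T d :=
  le_antisymm (φ.expSum_mono π s₁ T fun s a h => (hcd s a h).le)
    (φ.expSum_mono π s₁ T fun s a h => (hcd s a h).ge)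

theorem abs_expSum_potential_le (T : ℕ) (v : S → ℝ) {B : ℝ} (hB : ∀ s s', |v s - v s'| ≤ B) :
    |φ.expSum π s₁ T (fun e => v (φ.next e.1 e.2) - v e.1)| ≤ B := by
  unfold expSum
  have h := norm_integral_le_of_norm_le_const (μ := φ.law π s₁ T) (C := B)
    (f := fun h => ∑ t, (v (φ.next (h t).1.1 (h t).1.2) - v (h t).1.1)) ?_
  · simpa using h
  · filter_upwards [φ.ae_law π s₁ (K := fun s => act s) π.available v T] with h hh
    rw [hh.2]
    exact hB _ _

theorem value_eq_expSum (T : ℕ) : φ.value π s₁ T = φ.expSum π s₁ T (fun e => φ.r e.1 e.2) := rfl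

end DMDP

/-! ### Change of measure -/

namespace DMDP

variable {S A : Type} {act : S → Finset A} {F : S → A → ExpFamily}

/-- The logarithm of the density of the reward distribution of `φ` with respect to that
of `φ'`. -/
noncomputable def logRatio (φ φ' : DMDP S A act F) (y : (S × A) × ℝ) : ℝ :=
  (F y.1.1 y.1.2).logRatio (φ.param y.1.1 y.1.2) (φ'.param y.1.1 y.1.2) y.2

/-- The Kullback-Leibler divergence of the reward distributions at a state-action pair. -/
noncomputable def rewardDiv (φ φ' : DMDP S A act F) (e : S × A) : ℝ :=
  (F e.1 e.2).div (φ.param e.1 e.2) (φ'.param e.1 e.2)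

theorem rewardDiv_nonneg (φ φ' : DMDP S A act F) (e : S × A) : 0 ≤ φ.rewardDiv φ' e :=
  (F e.1 e.2).div_nonneg _ _

theorem rewardDiv_eq_zero (φ φ' : DMDP S A act F) (e : S × A)
    (h : φ'.param e.1 e.2 = φ.param e.1 e.2) : φ.rewardDiv φ' e = 0 := by
  rw [rewardDiv, h, ExpFamily.div_self]

theorem current_congr {φ φ' : DMDP S A act F} (h : φ'.next = φ.next) (s₁ : S) (t : ℕ) :
    φ'.current s₁ t = φ.current s₁ t := by
  cases t with
  | zero => rfl
  | succ t => funext x; simp only [current, h]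

theorem exists_abs_logRatio_le [Finite S] [Finite A] (φ φ' : DMDP S A act F) :
    ∃ C, ∀ y : (S × A) × ℝ, y.2 ∈ Set.Icc (0 : ℝ) 1 →
    ‖φ.logRatio φ' y‖ ≤ C := by
  obtain ⟨C, hC⟩ := (Set.finite_range fun e : S × A =>
    |φ.param e.1 e.2 - φ'.param e.1 e.2| + |(F e.1 e.2).logNorm (φ'.param e.1 e.2) -
      (F e.1 e.2).logNorm (φ.param e.1 e.2)|).bddAbove
  refine ⟨C, fun y hy => le_trans ?_ (hC ⟨y.1, rfl⟩)⟩
  refine (abs_add_le _ _).trans ?_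
  refine add_le_add_left ?_ _
  rw [abs_mul, abs_of_nonneg hy.1]
  exact mul_le_of_le_one_right (abs_nonneg _) hy.2

variable [Finite S] [Finite A] [MeasurableSpace S] [MeasurableSpace A]
  [MeasurableSingletonClass S] [MeasurableSingletonClass A]

theorem measurable_logRatio (φ φ' : DMDP S A act F) : Measurable (φ.logRatio φ') :=
  measurable_from_prod_countable_right fun e =>
    (F e.1 e.2).measurable_logRatio (φ.param e.1 e.2) (φ'.param e.1 e.2)

variable (φ φ' : DMDP S A act F) (π : Policy S A act) (s₁ : S)

/-- The current state and the law of the action are common to both processes, so only the reward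
contributes a density. -/
theorem step_eq_withDensity (hn : φ'.next = φ.next) {t : ℕ} (h : Fin t → (S × A) × ℝ) :
    φ'.step π s₁ t h = (φ.step π s₁ t h).withDensity
      (fun y => ENNReal.ofReal (Real.exp (-φ.logRatio φ' y))) := by
  have hm := φ.measurable_logRatio φ'
  refine Measure.ext_of_lintegral _ fun f hf => ?_
  rw [lintegral_withDensity_eq_lintegral_mul _ (by fun_prop) hf, lintegral_step _ _ _ _ hf,
    lintegral_step _ _ _ _ (by fun_prop), current_congr hn]
  refine lintegral_congr fun a => ?_
  have h1 : φ'.rewardDist (φ.current s₁ t h) a = (φ.rewardDist (φ.current s₁ t h) a).withDensity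
      (fun x => ENNReal.ofReal (Real.exp (-φ.logRatio φ' ((φ.current s₁ t h, a), x)))) :=
    (F _ a).dist_eq_withDensity _ _
  rw [h1, lintegral_withDensity_eq_lintegral_mul _ (by fun_prop) (by fun_prop)]
  rfl

/-- The log-likelihood ratio of a history. -/
noncomputable def histLogRatio (T : ℕ) (h : Fin T → (S × A) × ℝ) : ℝ :=
  ∑ t, φ.logRatio φ' (h t)

theorem measurable_histLogRatio (T : ℕ) : Measurable (φ.histLogRatio φ' T) := by
  have := φ.measurable_logRatio φ'
  unfold histLogRatio
  fun_prop

theorem law_eq_withDensity (hn : φ'.next = φ.next) (T : ℕ) :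
    φ'.law π s₁ T = (φ.law π s₁ T).withDensity
      (fun h => ENNReal.ofReal (Real.exp (-φ.histLogRatio φ' T h))) := by
  induction T with
  | zero =>
    have : (fun h : Fin 0 → (S × A) × ℝ =>
        ENNReal.ofReal (Real.exp (-φ.histLogRatio φ' 0 h))) = 1 := by
      funext h; simp [histLogRatio]
    rw [this, withDensity_one]
    rfl
  | succ T ih =>
    have hm := φ.measurable_logRatio φ'
    have hm1 := φ.measurable_histLogRatio φ' T
    have hm2 := φ.measurable_histLogRatio φ' (T + 1)
    refine Measure.ext_of_lintegral _ fun f hf => ?_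
    rw [lintegral_withDensity_eq_lintegral_mul _ (by fun_prop) hf, lintegral_law_succ _ _ _ hf,
      lintegral_law_succ _ _ _ (by fun_prop), ih,
      lintegral_withDensity_eq_lintegral_mul _ (by fun_prop)]
    · refine lintegral_congr fun h => ?_
      have hs : Measurable (fun y => f (Fin.snoc (α := fun _ => (S × A) × ℝ) h y)) :=
        (hf.comp (measurable_snoc T)).comp (measurable_const.prodMk measurable_id)
      rw [Pi.mul_apply, step_eq_withDensity φ φ' π s₁ hn,
        lintegral_withDensity_eq_lintegral_mul _ (by fun_prop) hs, ← lintegral_const_mul _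
        (Measurable.mul (by fun_prop) hs)]
      refine lintegral_congr fun y => ?_
      simp only [Pi.mul_apply]
      rw [← mul_assoc, ← ENNReal.ofReal_mul (Real.exp_pos _).le, ← Real.exp_add]
      congr 4
      unfold histLogRatio
      rw [Fin.sum_univ_castSucc]
      simp only [Fin.snoc_castSucc, Fin.snoc_last]
      ring
    · exact Measurable.lintegral_kernel_prod_right' (hf.comp (measurable_snoc T))

theorem ae_abs_histLogRatio_le {C : ℝ} (hC : ∀ y : (S × A) × ℝ, y.2 ∈ Set.Icc (0 : ℝ) 1 →
    ‖φ.logRatio φ' y‖ ≤ C) (T : ℕ) :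
    ∀ᵐ h ∂φ.law π s₁ T, ‖φ.histLogRatio φ' T h‖ ≤ T * C := by
  filter_upwards [φ.ae_law π s₁ (K := fun s => act s) π.available 0 T] with h hh
  refine (norm_sum_le _ _).trans ?_
  refine (Finset.sum_le_sum fun t _ => hC _ (hh.1 t).2).trans ?_
  simp

theorem integrable_histLogRatio (T : ℕ) :
    Integrable (φ.histLogRatio φ' T) (φ.law π s₁ T) := by
  obtain ⟨C, hC⟩ := φ.exists_abs_logRatio_le φ'
  exact Integrable.of_bound (φ.measurable_histLogRatio φ' T).aestronglyMeasurable _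
    (φ.ae_abs_histLogRatio_le φ' π s₁ hC T)

theorem integrable_logRatio_step {t : ℕ} (h : Fin t → (S × A) × ℝ) :
    Integrable (φ.logRatio φ') (φ.step π s₁ t h) := by
  obtain ⟨C, hC⟩ := φ.exists_abs_logRatio_le φ'
  refine Integrable.of_bound (φ.measurable_logRatio φ').aestronglyMeasurable C ?_
  filter_upwards [φ.ae_step π s₁ (K := fun s => act s) π.available h] with y hy using hC _ hy.2.2

theorem integrable_comp_fst_step {t : ℕ} (h : Fin t → (S × A) × ℝ) (c : S × A → ℝ) :
    Integrable (fun y => c y.1) (φ.step π s₁ t h) := by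
  have hc : Measurable c := measurable_of_countable c
  obtain ⟨C, hC⟩ := (Set.finite_range fun e => ‖c e‖).bddAbove
  exact Integrable.of_bound (hc.comp measurable_fst).aestronglyMeasurable C
    (Eventually.of_forall fun h => hC ⟨_, rfl⟩)

/-- Given the pair, the reward is drawn from its own member of the family, so the log-ratio averages
to the divergence there. -/
theorem integral_logRatio_step {t : ℕ} (h : Fin t → (S × A) × ℝ) :
    ∫ y, φ.logRatio φ' y ∂φ.step π s₁ t h = ∫ y, φ.rewardDiv φ' y.1 ∂φ.step π s₁ t h := by
  have := π.isMarkov t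
  have h1 := φ.integrable_logRatio_step φ' π s₁ h
  have h2 := φ.integrable_comp_fst_step π s₁ h (φ.rewardDiv φ')
  unfold step at h1 h2 ⊢
  rw [ProbabilityTheory.integral_compProd h1, ProbabilityTheory.integral_compProd h2]
  congr 1; ext e
  have h3 : ∫ x, φ.logRatio φ' (e, x) ∂(F e.1 e.2).dist (φ.param e.1 e.2) = φ.rewardDiv φ' e :=
    (F e.1 e.2).integral_logRatio (φ.param e.1 e.2) (φ'.param e.1 e.2)
  refine h3.trans ?_
  simp

/-- The divergence decomposition: by the chain rule each visit to a pair contributes the reward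
divergence of that pair, however the policy came to visit it. -/
theorem integral_histLogRatio (T : ℕ) :
    ∫ h, φ.histLogRatio φ' T h ∂φ.law π s₁ T = φ.expSum π s₁ T (φ.rewardDiv φ') := by
  induction T with
  | zero => simp [histLogRatio, expSum]
  | succ T ih =>
    unfold expSum at ih ⊢
    rw [integral_law_succ _ _ _ (φ.measurable_histLogRatio φ' _)
      (φ.integrable_histLogRatio φ' π s₁ _), integral_law_succ _ _ _ (measurable_sum _ _)
      (φ.integrable_sum π s₁ _ _)]
    have e1 : ∀ h, ∫ y, φ.histLogRatio φ' (T + 1) (Fin.snoc (α := fun _ => (S × A) × ℝ) h y)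
        ∂φ.step π s₁ T h =
        φ.histLogRatio φ' T h + ∫ y, φ.rewardDiv φ' y.1 ∂φ.step π s₁ T h := by
      intro h
      rw [← integral_logRatio_step]
      simp only [histLogRatio, Fin.sum_univ_castSucc, Fin.snoc_castSucc, Fin.snoc_last]
      rw [integral_add (integrable_const _) (φ.integrable_logRatio_step φ' π s₁ h)]
      simp
    have e2 : ∀ h, ∫ y, ∑ t, φ.rewardDiv φ'
          ((Fin.snoc (α := fun _ => (S × A) × ℝ) h y : Fin (T + 1) → (S × A) × ℝ) t).1
        ∂φ.step π s₁ T h =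
        (∑ t, φ.rewardDiv φ' (h t).1) + ∫ y, φ.rewardDiv φ' y.1 ∂φ.step π s₁ T h := by
      intro h
      simp only [Fin.sum_univ_castSucc, Fin.snoc_castSucc, Fin.snoc_last]
      rw [integral_add (integrable_const _) (φ.integrable_comp_fst_step π s₁ h _)]
      simp
    simp only [e1, e2]
    have h3 : Integrable (fun h => ∫ y, φ.rewardDiv φ' y.1 ∂φ.step π s₁ T h) (φ.law π s₁ T) := by
      have hc : Measurable (φ.rewardDiv φ') := measurable_of_countable _
      obtain ⟨C, hC⟩ := (Set.finite_range fun e => ‖φ.rewardDiv φ' e‖).bddAbove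
      refine Integrable.of_bound
        ((hc.comp measurable_fst).stronglyMeasurable.integral_kernel).aestronglyMeasurable C
        (Eventually.of_forall fun h => ?_)
      have := norm_integral_le_of_norm_le_const (μ := φ.step π s₁ T h) (C := C)
        (f := fun y => φ.rewardDiv φ' y.1) (Eventually.of_forall fun y => hC ⟨y.1, rfl⟩)
      simpa using this
    rw [integral_add (φ.integrable_histLogRatio φ' π s₁ T) h3,
      integral_add (φ.integrable_sum π s₁ T _) h3, ih]

/-- The Gibbs variational inequality for the laws of two processes with the same transitions. -/
theorem integral_sub_histLogRatio_le (hn : φ'.next = φ.next) (T : ℕ)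
    {Z : (Fin T → (S × A) × ℝ) → ℝ} (hZ : Measurable Z) {B : ℝ} (hB : ∀ h, |Z h| ≤ B) :
    1 + ∫ h, Z h ∂φ.law π s₁ T - φ.expSum π s₁ T (φ.rewardDiv φ') ≤
      ∫ h, Real.exp (Z h) ∂φ'.law π s₁ T := by
  have hm := φ.measurable_histLogRatio φ' T
  have hL := φ.integrable_histLogRatio φ' π s₁ T
  have hZi : Integrable Z (φ.law π s₁ T) :=
    Integrable.of_bound hZ.aestronglyMeasurable B (Eventually.of_forall hB)
  obtain ⟨C, hC⟩ := φ.exists_abs_logRatio_le φ'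
  have hE : Integrable (fun h => Real.exp (-φ.histLogRatio φ' T h) * Real.exp (Z h))
      (φ.law π s₁ T) := by
    refine Integrable.of_bound (by fun_prop) (Real.exp (T * C + B)) ?_
    filter_upwards [φ.ae_abs_histLogRatio_le φ' π s₁ hC T] with h hh
    rw [← Real.exp_add, Real.norm_eq_abs, Real.abs_exp]
    refine Real.exp_le_exp.2 (add_le_add ((neg_le_abs _).trans hh) ((le_abs_self _).trans (hB h)))
  rw [law_eq_withDensity φ φ' π s₁ hn, integral_withDensity_eq_integral_toReal_smul (by fun_prop)
    (by simp), ← integral_histLogRatio]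
  simp only [ENNReal.toReal_ofReal (Real.exp_pos _).le, smul_eq_mul]
  have h1 : 1 + ∫ h, Z h ∂φ.law π s₁ T - ∫ h, φ.histLogRatio φ' T h ∂φ.law π s₁ T =
      ∫ h, (1 + Z h - φ.histLogRatio φ' T h) ∂φ.law π s₁ T := by
    have h2 : Integrable (fun h => 1 + Z h) (φ.law π s₁ T) := (integrable_const _).add hZi
    rw [integral_sub h2 hL, integral_add (integrable_const _) hZi]
    simp
  rw [h1]
  refine integral_mono (((integrable_const _).add hZi).sub hL) hE fun h => ?_
  dsimp only
  rw [← Real.exp_add]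
  -- The Gibbs inequality reduces to `1 + u ≤ exp u` under the law of `φ`, the density having turned
  -- `exp Z` into `exp (Z - L)` with `L` the log-likelihood ratio.
  have := Real.add_one_le_exp (-φ.histLogRatio φ' T h + Z h)
  linarith

/-- An event frequent under `φ` and rare under `φ'` forces a large divergence. This is the Gibbs
inequality for `l` times the time average of `w`. -/
theorem mul_expSum_le (hn : φ'.next = φ.next) {T : ℕ} (hT : 0 < T) {w : S × A → ℝ}
    (hw0 : ∀ e, 0 ≤ w e) (hw1 : ∀ e, w e ≤ 1) {l : ℝ} (hl : 0 ≤ l) :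
    l * (φ.expSum π s₁ T w / T) ≤
      φ.expSum π s₁ T (φ.rewardDiv φ') + Real.exp l * (φ'.expSum π s₁ T w / T) := by
  have hT' : (0 : ℝ) < T := by exact_mod_cast hT
  set W : (Fin T → (S × A) × ℝ) → ℝ := fun h => (∑ t, w (h t).1) / T with hW
  have hWm : Measurable W := (measurable_sum T w).div_const _
  have hW0 : ∀ h, 0 ≤ W h := fun h => div_nonneg (Finset.sum_nonneg fun t _ => hw0 _) hT'.le
  have hW1 : ∀ h, W h ≤ 1 := fun h => by
    rw [hW]
    refine (div_le_one hT').2 ((Finset.sum_le_sum fun t _ => hw1 _).trans ?_)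
    simp
  have h1 := φ.integral_sub_histLogRatio_le φ' π s₁ hn T (hWm.const_mul l) (B := l) fun h => by
    rw [abs_of_nonneg (mul_nonneg hl (hW0 h))]
    exact mul_le_of_le_one_right hl (hW1 h)
  have h2 : ∫ h, Real.exp (l * W h) ∂φ'.law π s₁ T ≤
      ∫ h, (1 + Real.exp l * W h) ∂φ'.law π s₁ T := by
    have hWi : Integrable W (φ'.law π s₁ T) := (φ'.integrable_sum π s₁ T w).div_const _
    refine integral_mono ?_ ((integrable_const _).add (hWi.const_mul _)) fun h => ?_
    · refine Integrable.of_bound (by fun_prop) (Real.exp l) (Eventually.of_forall fun h => ?_)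
      rw [Real.norm_eq_abs, Real.abs_exp]
      exact Real.exp_le_exp.2 (mul_le_of_le_one_right hl (hW1 h))
    -- The chord of `exp` over `[0, l]` gives `exp (l W) ≤ 1 - W + W exp l`; the term `-W` is
    -- dropped.
    · have := convexOn_exp.2 (Set.mem_univ 0) (Set.mem_univ l) (sub_nonneg.2 (hW1 h)) (hW0 h)
        (by ring)
      simp only [smul_eq_mul, mul_zero, zero_add, Real.exp_zero, mul_one] at this
      rw [mul_comm l]
      nlinarith [hW0 h]
  have h3 : ∀ ψ : DMDP S A act F, ∫ h, W h ∂ψ.law π s₁ T = ψ.expSum π s₁ T w / T := fun ψ => by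
    rw [hW, integral_div]; rfl
  rw [integral_add (integrable_const _)
    (((φ'.integrable_sum π s₁ T w).div_const _).const_mul _), integral_const_mul, h3] at h2
  rw [integral_const_mul, h3] at h1
  simp only [integral_const, probReal_univ, smul_eq_mul, mul_one] at h2
  linarith

end DMDP

/-! ### Structure of the line -/

/-- The centred partial sums have period 2 from `t₀` on, hence are bounded, and division by `T`
removes them. -/
theorem tendsto_average_of_add_succ_eq {x : ℕ → ℝ} {g : ℝ} {t₀ : ℕ}
    (h : ∀ T, t₀ ≤ T → x T + x (T + 1) = 2 * g) :
    Tendsto (fun T : ℕ => (∑ t ∈ Finset.range T, x t) / (T : ℝ)) atTop (𝓝 g) := by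
  set D : ℕ → ℝ := fun T => (∑ t ∈ Finset.range T, x t) - T * g with hD
  have hper : ∀ T, t₀ ≤ T → D (T + 2) = D T := by
    intro T hT
    have := h T hT
    simp only [hD, Finset.sum_range_succ, Nat.cast_add, Nat.cast_ofNat]
    linarith
  have hle : ∀ T, |D T| ≤ ∑ k ∈ Finset.range (t₀ + 2), |D k| := by
    intro T
    induction T using Nat.strong_induction_on with
    | _ T ih =>
      rcases lt_or_ge T (t₀ + 2) with hT | hT
      · exact Finset.single_le_sum (f := fun k => |D k|) (fun k _ => abs_nonneg _)
          (Finset.mem_range.2 hT)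
      · obtain ⟨k, rfl⟩ := Nat.exists_eq_add_of_le' (show 2 ≤ T by omega)
        rw [hper k (by omega)]
        exact ih k (by omega)
  have h0 : Tendsto (fun T : ℕ => D T / (T : ℝ)) atTop (𝓝 0) := by
    have h1 : Tendsto (fun T : ℕ => (∑ k ∈ Finset.range (t₀ + 2), |D k|) / (T : ℝ)) atTop (𝓝 0) :=
      tendsto_const_nhds.div_atTop tendsto_natCast_atTop_atTop
    refine squeeze_zero_norm (fun T => ?_) h1
    rw [norm_div, Real.norm_eq_abs, Real.norm_natCast]
    exact div_le_div_of_nonneg_right (hle T) (Nat.cast_nonneg T)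
  have h2 := h0.add_const g
  rw [zero_add] at h2
  refine h2.congr' ?_
  filter_upwards [eventually_gt_atTop 0] with T hT
  have : (T : ℝ) ≠ 0 := by exact_mod_cast hT.ne'
  simp only [hD]
  field_simp
  ring

theorem lineAct_cases {n : ℕ} {s : Fin (n + 1)} {a : Fin 2} (h : a ∈ lineAct n s) :
    (∃ i : Fin n, s = i.castSucc ∧ a = 0) ∨ ∃ i : Fin n, s = i.succ ∧ a = 1 := by
  simp only [lineAct, Finset.mem_filter, Finset.mem_univ, true_and] at h
  obtain rfl | rfl : a = 0 ∨ a = 1 := by omega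
  · exact Or.inl ⟨s.castPred (h.1 rfl), by simp, rfl⟩
  · exact Or.inr ⟨s.pred (h.2 rfl), by simp, rfl⟩

theorem zero_mem_lineAct {n : ℕ} (i : Fin n) : 0 ∈ lineAct n i.castSucc := by
  simp [lineAct, Fin.castSucc_ne_last]

theorem one_mem_lineAct {n : ℕ} (i : Fin n) : 1 ∈ lineAct n i.succ := by
  simp [lineAct]

/-- The stationary policy that walks to the cycle `Cᵢ` and stays there. -/
def towards {n : ℕ} (i : Fin n) : DMDP.Stationary (Fin (n + 1)) (Fin 2) (lineAct n) :=
  ⟨fun s => if s ≤ i.castSucc then 0 else 1, fun s => by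
    by_cases h : s ≤ i.castSucc
    · simp only [h, if_true, lineAct, Finset.mem_filter, Finset.mem_univ, true_and]
      refine ⟨fun _ hs => ?_, by simp⟩
      subst hs
      exact absurd h (not_le.2 (Fin.castSucc_lt_last i))
    · simp only [h, if_false, lineAct, Finset.mem_filter, Finset.mem_univ, true_and]
      refine ⟨by simp, fun _ hs => h ?_⟩
      subst hs
      exact Fin.zero_le _⟩

/-- The policy turns from rightward to leftward moves only across edge `i`, so no other cycle can
trap it. -/
theorem eq_of_towards {n : ℕ} {i j : Fin n} (h0 : (towards i).1 j.castSucc = 0)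
    (h1 : (towards i).1 j.succ = 1) : j = i := by
  simp only [towards, ite_eq_left_iff, ite_eq_right_iff, one_ne_zero, imp_false,
    not_not, Fin.le_def, Fin.val_castSucc, Fin.val_succ, zero_ne_one] at h0 h1
  ext; omega

namespace DMDP

section General

variable {S A : Type} {act : S → Finset A} {F : S → A → ExpFamily}

theorem sum_chain_potential (φ : DMDP S A act F) (v : S → ℝ) (e : S × A) (C : List (S × A))
    (h : (e :: C).IsChain (fun e e' => φ.next e.1 e.2 = e'.1)) :
    ((e :: C).map (fun e => v (φ.next e.1 e.2) - v e.1)).sum =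
      v (φ.next ((e :: C).getLast (by simp)).1 ((e :: C).getLast (by simp)).2) - v e.1 := by
  induction C generalizing e with
  | nil => simp
  | cons e' C ih =>
    rw [List.isChain_cons_cons] at h
    rw [List.map_cons, List.sum_cons, ih e' h.2, h.1, List.getLast_cons (List.cons_ne_nil _ _)]
    ring

theorem IsSimpleCycle.sum_potential {φ : DMDP S A act F} {C : List (S × A)}
    (h : φ.IsSimpleCycle C) (v : S → ℝ) :
    (C.map (fun e => v (φ.next e.1 e.2) - v e.1)).sum = 0 := by
  obtain ⟨-, hc, -, hne, hl⟩ := h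
  cases C with
  | nil => exact absurd rfl hne
  | cons e C => rw [φ.sum_chain_potential v e C hc, hl, List.head_cons, sub_self]

/-- The indicator of a state-action pair. -/
noncomputable def pairInd (p e : S × A) : ℝ := Set.indicator {p} 1 e

theorem pairInd_self (p : S × A) : pairInd p p = 1 := by simp [pairInd]

theorem pairInd_of_ne {p e : S × A} (h : e ≠ p) : pairInd p e = 0 := by simp [pairInd, h]

theorem pairInd_nonneg (p e : S × A) : 0 ≤ pairInd p e :=
  Set.indicator_nonneg (fun _ _ => zero_le_one) _

theorem expVisits_eq_expSum_pairInd [Finite S] [Finite A] [MeasurableSpace S] [MeasurableSpace A]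
    [MeasurableSingletonClass S] [MeasurableSingletonClass A]
    (φ : DMDP S A act F) (π : Policy S A act) (s₁ : S) (T : ℕ) (s : S) (a : A) :
    φ.expVisits π s₁ T s a = φ.expSum π s₁ T (pairInd (s, a)) := by
  classical
  unfold expVisits expSum
  congr 1; ext h
  rw [← Finset.sum_boole]
  refine Finset.sum_congr rfl fun t _ => ?_
  simp [pairInd, Set.indicator_apply]

end General

/-! ### Decomposition of the line into its two-step cycles. -/

variable {n : ℕ} {F : Fin (n + 1) → Fin 2 → ExpFamily}

theorem cycleGain_lineCycle (φ : DMDP (Fin (n + 1)) (Fin 2) (lineAct n) F) (i : Fin n) :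
    φ.cycleGain (lineCycle i) = (φ.r i.castSucc 0 + φ.r i.succ 1) / 2 := by
  simp [cycleGain, lineCycle]

/-- The indicator of the cycle `Cᵢ`. -/
noncomputable def cycleInd (i : Fin n) (e : Fin (n + 1) × Fin 2) : ℝ :=
  pairInd (i.castSucc, 0) e + pairInd (i.succ, 1) e

theorem cycleInd_nonneg (i : Fin n) (e : Fin (n + 1) × Fin 2) : 0 ≤ cycleInd i e :=
  add_nonneg (pairInd_nonneg _ _) (pairInd_nonneg _ _)

theorem cycleInd_castSucc (i j : Fin n) : cycleInd i (j.castSucc, 0) = if i = j then 1 else 0 := by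
  unfold cycleInd
  rw [pairInd_of_ne (p := (i.succ, 1)) (by simp), add_zero]
  split_ifs with h
  · rw [h, pairInd_self]
  · exact pairInd_of_ne (by simpa using Ne.symm h)

theorem cycleInd_succ (i j : Fin n) : cycleInd i (j.succ, 1) = if i = j then 1 else 0 := by
  unfold cycleInd
  rw [pairInd_of_ne (p := (i.castSucc, 0)) (by simp), zero_add]
  split_ifs with h
  · rw [h, pairInd_self]
  · exact pairInd_of_ne (by simpa using Ne.symm h)

theorem cycleInd_le_one (i : Fin n) (e : Fin (n + 1) × Fin 2) : cycleInd i e ≤ 1 := by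
  unfold cycleInd
  by_cases h : e = (i.castSucc, 0)
  · rw [h, pairInd_self, pairInd_of_ne (by simp)]; norm_num
  · rw [pairInd_of_ne h, zero_add]
    exact Set.indicator_le_self' (s := {(i.succ, 1)}) (f := 1) (fun _ _ => zero_le_one) e

theorem sum_mul_cycleInd_castSucc (c : Fin n → ℝ) (j : Fin n) :
    ∑ i, c i * cycleInd i (j.castSucc, 0) = c j := by simp [cycleInd_castSucc]

theorem sum_mul_cycleInd_succ (c : Fin n → ℝ) (j : Fin n) :
    ∑ i, c i * cycleInd i (j.succ, 1) = c j := by simp [cycleInd_succ]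

theorem sum_cycleInd {s : Fin (n + 1)} {a : Fin 2} (h : a ∈ lineAct n s) :
    ∑ i, cycleInd i (s, a) = 1 := by
  obtain ⟨i, rfl, rfl⟩ | ⟨i, rfl, rfl⟩ := lineAct_cases h
  · simp [cycleInd_castSucc]
  · simp [cycleInd_succ]

variable (φ : DMDP (Fin (n + 1)) (Fin 2) (lineAct n) F)

/-- The gain of the cycle `Cᵢ` to which a state-action pair belongs. -/
noncomputable def edgeGain (e : Fin (n + 1) × Fin 2) : ℝ :=
  ∑ i, φ.cycleGain (lineCycle i) * cycleInd i e

theorem edgeGain_castSucc (i : Fin n) :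
    φ.edgeGain (i.castSucc, 0) = φ.cycleGain (lineCycle i) := sum_mul_cycleInd_castSucc _ i

theorem edgeGain_succ (i : Fin n) :
    φ.edgeGain (i.succ, 1) = φ.cycleGain (lineCycle i) := sum_mul_cycleInd_succ _ i

/-- The potential whose increments are the differences of the rewards and the cycle gains. -/
noncomputable def potential : Fin (n + 1) → ℝ :=
  Fin.partialSum (fun i : Fin n => φ.r i.castSucc 0 - φ.cycleGain (lineCycle i))

variable {φ}

/-- The gain of a cycle is the average of its two rewards, so these deviate from it by opposite
amounts, and so do the potential increments of the two opposite moves. -/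
theorem IsLineSearch.r_eq (hφ : φ.IsLineSearch) {s : Fin (n + 1)} {a : Fin 2}
    (h : a ∈ lineAct n s) :
    φ.r s a = φ.edgeGain (s, a) + (φ.potential (φ.next s a) - φ.potential s) := by
  obtain ⟨i, rfl, rfl⟩ | ⟨i, rfl, rfl⟩ := lineAct_cases h
  · rw [edgeGain_castSucc, (hφ i).1, potential, Fin.partialSum_succ]
    ring
  · rw [edgeGain_succ, (hφ i).2, potential, Fin.partialSum_succ, cycleGain_lineCycle]
    ring

/-- A stationary policy keeps its direction until it meets a state that sends it back, at the latest
an end of the line; from then on it oscillates across one edge. -/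
theorem IsLineSearch.exists_orbit_eq (hφ : φ.IsLineSearch)
    (f : Stationary (Fin (n + 1)) (Fin 2) (lineAct n)) (s : Fin (n + 1)) :
    ∃ t, ∃ j : Fin n, φ.orbit f s t = j.castSucc ∧ f.1 j.castSucc = 0 ∧ f.1 j.succ = 1 := by
  have hs : ∀ s t, φ.orbit f s (t + 1) = φ.orbit f (φ.next s (f.1 s)) t := fun s t => rfl
  have ha : ∀ a : Fin 2, a = 0 ∨ a = 1 := by omega
  rcases ha (f.1 s) with h | h
  -- The induction starts at the end towards which the policy moves; there this direction is
  -- unavailable.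
  · induction s using Fin.reverseInduction with
    | last =>
      have := f.2 (Fin.last n)
      simp [h, lineAct] at this
    | cast i ih =>
      rcases ha (f.1 i.succ) with h1 | h1
      · obtain ⟨t, j, hj⟩ := ih h1
        exact ⟨t + 1, j, by rwa [hs, h, (hφ i).1]⟩
      · exact ⟨0, i, rfl, h, h1⟩
  · induction s using Fin.induction with
    | zero =>
      have := f.2 0
      simp [h, lineAct] at this
    | succ i ih =>
      rcases ha (f.1 i.castSucc) with h1 | h1
      · exact ⟨1, i, by rw [hs, h, (hφ i).2]; rfl, h1, h⟩
      · obtain ⟨t, j, hj⟩ := ih h1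
        exact ⟨t + 1, j, by rwa [hs, h, (hφ i).2]⟩

theorem IsLineSearch.gain_eq (hφ : φ.IsLineSearch)
    {f : Stationary (Fin (n + 1)) (Fin 2) (lineAct n)} {s : Fin (n + 1)} {t₀ : ℕ} {j : Fin n}
    (ht : φ.orbit f s t₀ = j.castSucc) (h0 : f.1 j.castSucc = 0) (h1 : f.1 j.succ = 1) :
    φ.gain f s = φ.cycleGain (lineCycle j) := by
  have hs : ∀ t, φ.orbit f s (t + 1) = φ.next (φ.orbit f s t) (f.1 (φ.orbit f s t)) := fun t => by
    unfold orbit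
    rw [Function.iterate_succ_apply']
  have horb : ∀ T, t₀ ≤ T → φ.orbit f s T = j.castSucc ∨ φ.orbit f s T = j.succ := by
    intro T hT
    induction T, hT using Nat.le_induction with
    | base => exact Or.inl ht
    | succ T _ ih =>
      rcases ih with h | h
      · right; rw [hs, h, h0, (hφ j).1]
      · left; rw [hs, h, h1, (hφ j).2]
  refine (tendsto_average_of_add_succ_eq (t₀ := t₀) fun T hT => ?_).limUnder_eq
  rw [cycleGain_lineCycle, hs T]
  rcases horb T hT with h | h
  · rw [h, h0, (hφ j).1, h1]; ring
  · rw [h, h1, (hφ j).2, h0]; ring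

theorem IsLineSearch.cycleGain_le_optGain (hφ : φ.IsLineSearch) (s : Fin (n + 1)) (i : Fin n) :
    φ.cycleGain (lineCycle i) ≤ φ.optGain s := by
  obtain ⟨t, j, h, h0, h1⟩ := hφ.exists_orbit_eq (towards i) s
  obtain rfl := eq_of_towards h0 h1
  rw [← hφ.gain_eq h h0 h1]
  exact le_ciSup (f := fun f : Stationary (Fin (n + 1)) (Fin 2) (lineAct n) => φ.gain f s)
    (Set.finite_range _).bddAbove (towards j)

theorem IsLineSearch.exists_optGain_eq (hφ : φ.IsLineSearch) (hn : 1 ≤ n) (s : Fin (n + 1)) :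
    ∃ i : Fin n, φ.optGain s = φ.cycleGain (lineCycle i) := by
  have : Nonempty (Stationary (Fin (n + 1)) (Fin 2) (lineAct n)) := ⟨towards ⟨0, hn⟩⟩
  obtain ⟨f, hf⟩ := exists_eq_ciSup_of_finite
    (f := fun f : Stationary (Fin (n + 1)) (Fin 2) (lineAct n) => φ.gain f s)
  obtain ⟨t, j, h, h0, h1⟩ := hφ.exists_orbit_eq f s
  exact ⟨j, hf.symm.trans (hφ.gain_eq h h0 h1)⟩

theorem IsLineSearch.communicating (hφ : φ.IsLineSearch) (hn : 1 ≤ n) : φ.Communicating := by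
  intro s s'
  refine Fin.cases ?_ (fun i => ?_) s'
  · obtain ⟨t, j, h, h0, h1⟩ := hφ.exists_orbit_eq (towards ⟨0, hn⟩) s
    obtain rfl := eq_of_towards h0 h1
    exact ⟨_, t, h⟩
  · obtain ⟨t, j, h, h0, h1⟩ := hφ.exists_orbit_eq (towards i) s
    obtain rfl := eq_of_towards h0 h1
    refine ⟨towards j, t + 1, ?_⟩
    unfold orbit at h ⊢
    rw [Function.iterate_succ_apply', h, h0, (hφ j).1]

theorem IsLineSearch.edgeGain_le_optGain (hφ : φ.IsLineSearch) (x : Fin (n + 1))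
    {s : Fin (n + 1)} {a : Fin 2} (h : a ∈ lineAct n s) :
    φ.edgeGain (s, a) ≤ φ.optGain x := by
  obtain ⟨i, rfl, rfl⟩ | ⟨i, rfl, rfl⟩ := lineAct_cases h
  · exact (φ.edgeGain_castSucc i).trans_le (hφ.cycleGain_le_optGain x i)
  · exact (φ.edgeGain_succ i).trans_le (hφ.cycleGain_le_optGain x i)

/-- Around a simple cycle the potential cancels, so the edge gains average to the optimal gain; none
exceeds it, so all equal it. Thus uniform goodness applies to every pair of a suboptimal
`lineCycle`. -/
theorem IsLineSearch.edgeGain_eq_of_onOptimalCycle (hφ : φ.IsLineSearch) (x : Fin (n + 1))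
    {s : Fin (n + 1)} {a : Fin 2} (h : φ.OnOptimalCycle s a) :
    φ.edgeGain (s, a) = φ.optGain x := by
  obtain ⟨C, hC, hg, hmem⟩ := h
  have hlen : (0 : ℝ) < C.length := by exact_mod_cast List.length_pos_of_mem hmem
  have h1 : (C.map (fun e => φ.r e.1 e.2)).sum = (C.map φ.edgeGain).sum := by
    rw [← add_zero (C.map φ.edgeGain).sum, ← hC.sum_potential φ.potential, ← List.sum_map_add]
    exact congrArg List.sum (List.map_congr_left fun e he => hφ.r_eq (hC.1 e he))
  have h2 := hg x
  rw [cycleGain, h1, div_eq_iff hlen.ne'] at h2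
  by_contra hne
  have hle : ∀ e ∈ C, φ.edgeGain e ≤ φ.optGain x := fun e he =>
    hφ.edgeGain_le_optGain x (hC.1 e he)
  have h3 : (C.map φ.edgeGain).sum < (C.map fun _ => φ.optGain x).sum :=
    List.sum_lt_sum _ _ hle ⟨_, hmem, lt_of_le_of_ne (hle _ hmem) hne⟩
  rw [h2, List.map_const', List.sum_replicate, nsmul_eq_mul, mul_comm] at h3
  exact lt_irrefl _ h3

end DMDP

/-! ### Regret -/

section StationaryPolicy

variable {S A : Type} {act : S → Finset A} [Finite S] [MeasurableSpace S]
  [MeasurableSpace A] [MeasurableSingletonClass S] [MeasurableSingletonClass A]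

/-- A stationary deterministic policy as a policy. -/
noncomputable def DMDP.Stationary.toPolicy (f : DMDP.Stationary S A act) : Policy S A act where
  choice t := Kernel.deterministic (fun p => f.1 p.2)
    ((measurable_of_countable f.1).comp measurable_snd)
  isMarkov t := inferInstance
  available t h s a ha := by
    rw [Kernel.deterministic_apply, Measure.dirac_apply' _ (measurableSet_singleton a)]
    refine Set.indicator_of_notMem ?_ _
    rintro rfl
    exact ha (f.2 s)

theorem DMDP.Stationary.toPolicy_choice (f : DMDP.Stationary S A act) (t : ℕ)
    (h : Fin t → (S × A) × ℝ) (s : S) (a : A) (ha : a ∉ ({f.1 s} : Set A)) :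
    f.toPolicy.choice t (h, s) {a} = 0 := by
  simp only [toPolicy]
  rw [Kernel.deterministic_apply, Measure.dirac_apply' _ (measurableSet_singleton a)]
  refine Set.indicator_of_notMem ?_ _
  rintro rfl
  exact ha rfl

theorem DMDP.value_le [Finite A] {F : S → A → ExpFamily} (φ : DMDP S A act F)
    (π : Policy S A act) (s₁ : S) (T : ℕ) : φ.value π s₁ T ≤ T := by
  rw [value_eq_expSum]
  refine (φ.expSum_mono π s₁ T (d := fun _ => 1) fun s a _ => φ.r_le_one s a).trans ?_
  rw [expSum_const, mul_one]

theorem DMDP.value_le_iSup [Finite A] {F : S → A → ExpFamily} (φ : DMDP S A act F)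
    (π : Policy S A act) (s₁ : S) (T : ℕ) : φ.value π s₁ T ≤ ⨆ π' : Policy S A act, φ.value π' s₁ T :=
  le_ciSup (f := fun π' : Policy S A act => φ.value π' s₁ T)
    ⟨T, by rintro _ ⟨π', rfl⟩; exact φ.value_le π' s₁ T⟩ π

end StationaryPolicy

theorem exists_abs_sub_le {S : Type} [Finite S] (v : S → ℝ) : ∃ B, ∀ s s', |v s - v s'| ≤ B := by
  obtain ⟨B, hB⟩ := (Set.finite_range fun p : S × S => |v p.1 - v p.2|).bddAbove
  exact ⟨B, fun s s' => hB ⟨(s, s'), rfl⟩⟩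

namespace DMDP

variable {n : ℕ} {F : Fin (n + 1) → Fin 2 → ExpFamily}
  {φ : DMDP (Fin (n + 1)) (Fin 2) (lineAct n) F}

theorem cycleGain_lineCycle_nonneg (φ : DMDP (Fin (n + 1)) (Fin 2) (lineAct n) F) (i : Fin n) :
    0 ≤ φ.cycleGain (lineCycle i) := by
  rw [cycleGain_lineCycle]
  linarith [φ.r_nonneg i.castSucc 0, φ.r_nonneg i.succ 1]

theorem cycleGain_lineCycle_le_one (φ : DMDP (Fin (n + 1)) (Fin 2) (lineAct n) F) (i : Fin n) :
    φ.cycleGain (lineCycle i) ≤ 1 := by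
  rw [cycleGain_lineCycle]
  linarith [φ.r_le_one i.castSucc 0, φ.r_le_one i.succ 1]

theorem IsLineSearch.exists_abs_value_sub_le (hφ : φ.IsLineSearch) :
    ∃ B, ∀ (π : Policy (Fin (n + 1)) (Fin 2) (lineAct n)) (s₁ : Fin (n + 1)) (T : ℕ),
      |φ.value π s₁ T - φ.expSum π s₁ T φ.edgeGain| ≤ B := by
  obtain ⟨B, hB⟩ := exists_abs_sub_le φ.potential
  refine ⟨B, fun π s₁ T => ?_⟩
  have h := φ.abs_expSum_potential_le π s₁ T φ.potential hB
  rw [value_eq_expSum, φ.expSum_congr π s₁ T (c := fun e => φ.r e.1 e.2)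
    (d := fun e => φ.edgeGain e + (φ.potential (φ.next e.1 e.2) - φ.potential e.1))
    fun s a ha => hφ.r_eq ha, expSum_add, add_sub_cancel_left]
  exact h

/-- The position, folded around the cycle `Cᵢ`. -/
def fold (i : Fin n) (s : Fin (n + 1)) : ℝ :=
  if s ≤ i.castSucc then (s : ℝ) else 2 * (i : ℝ) + 1 - s

/-- On the way to the cycle each step raises `fold` by 1, which covers any loss of gain since gains
lie in `[0, 1]`; on the cycle `fold` is constant. Hence reaching a best cycle costs a bounded
amount. -/
theorem IsLineSearch.cycleGain_le_add_fold (hφ : φ.IsLineSearch) {i : Fin n} (s : Fin (n + 1)) :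
    φ.cycleGain (lineCycle i) ≤ φ.edgeGain (s, (towards i).1 s) +
      (fold i (φ.next s ((towards i).1 s)) - fold i s) := by
  have hi1 := φ.cycleGain_lineCycle_le_one i
  rcases lineAct_cases ((towards i).2 s) with ⟨j, rfl, hj⟩ | ⟨j, rfl, hj⟩
  · have hji : j ≤ i := by simpa [towards] using hj
    rw [hj, edgeGain_castSucc, (hφ j).1]
    rcases hji.eq_or_lt with rfl | hlt
    · simp [fold, Fin.le_def]
      linarith
    · have h1 : j.succ ≤ i.castSucc := by
        simp only [Fin.le_def, Fin.val_succ, Fin.val_castSucc]; exact hlt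
      have := φ.cycleGain_lineCycle_nonneg j
      simp only [fold, h1, if_true, Fin.castSucc_le_castSucc_iff, hji, Fin.val_succ,
        Fin.val_castSucc, Nat.cast_add, Nat.cast_one]
      linarith
  · have hji : i ≤ j := by
      by_contra! hlt
      have h1 : j.succ ≤ i.castSucc := by
        simp only [Fin.le_def, Fin.val_succ, Fin.val_castSucc]; exact hlt
      simp [towards, h1] at hj
    rw [hj, edgeGain_succ, (hφ j).2]
    have h2 : ¬ j.succ ≤ i.castSucc := by
      simp only [Fin.le_def, Fin.val_succ, Fin.val_castSucc] at hji ⊢; omega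
    rcases hji.eq_or_lt with rfl | hlt
    · simp [fold, h2]
      linarith
    · have h1 : ¬ j.castSucc ≤ i.castSucc := fun h =>
        absurd (Fin.castSucc_le_castSucc_iff.1 h) (not_le.2 hlt)
      have := φ.cycleGain_lineCycle_nonneg j
      simp only [fold, h1, h2, if_false, Fin.val_succ, Fin.val_castSucc, Nat.cast_add,
        Nat.cast_one]
      linarith

theorem IsLineSearch.exists_le_iSup_value (hφ : φ.IsLineSearch) (hn : 1 ≤ n) (s₁ : Fin (n + 1)) :
    ∃ B, ∀ T : ℕ, T * φ.optGain s₁ - B ≤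
      ⨆ π' : Policy (Fin (n + 1)) (Fin 2) (lineAct n), φ.value π' s₁ T := by
  obtain ⟨i, hi⟩ := hφ.exists_optGain_eq hn s₁
  obtain ⟨B, hB⟩ := hφ.exists_abs_value_sub_le
  obtain ⟨B', hB'⟩ := exists_abs_sub_le (fold i)
  refine ⟨B + B', fun T => le_trans ?_ (φ.value_le_iSup (towards i).toPolicy s₁ T)⟩
  have h1 := φ.expSum_mono_of_support (towards i).toPolicy s₁
    (K := fun s => {(towards i).1 s}) (towards i).toPolicy_choice T
    (c := fun _ => φ.optGain s₁)
    (d := fun e => φ.edgeGain e + (fold i (φ.next e.1 e.2) - fold i e.1)) fun s a ha => by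
      rw [Set.mem_singleton_iff.1 ha, hi]
      exact hφ.cycleGain_le_add_fold s
  rw [expSum_const, expSum_add] at h1
  have h2 := (abs_le.1 (φ.abs_expSum_potential_le (towards i).toPolicy s₁ T (fold i) hB')).2
  have h3 := (abs_le.1 (hB (towards i).toPolicy s₁ T)).1
  linarith

/-- The times spent on the cycles add up to `T`. Only a lower bound on the best value is needed, and
walking to an optimal cycle supplies it. -/
theorem IsLineSearch.exists_le_regret (hφ : φ.IsLineSearch) (hn : 1 ≤ n) (s₁ : Fin (n + 1)) :
    ∃ B, ∀ (π : Policy (Fin (n + 1)) (Fin 2) (lineAct n)) (T : ℕ),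
      ∑ i, (φ.optGain s₁ - φ.cycleGain (lineCycle i)) * φ.expSum π s₁ T (cycleInd i) - B ≤
        φ.regret π s₁ T := by
  obtain ⟨B, hB⟩ := hφ.exists_abs_value_sub_le
  obtain ⟨B', hB'⟩ := hφ.exists_le_iSup_value hn s₁
  refine ⟨B + B', fun π T => ?_⟩
  have h1 : (T : ℝ) = ∑ i, φ.expSum π s₁ T (cycleInd i) := by
    rw [← expSum_sum, ← mul_one (T : ℝ), ← φ.expSum_const π s₁ T 1]
    exact φ.expSum_congr π s₁ T fun s a ha => (sum_cycleInd ha).symm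
  have h2 : φ.expSum π s₁ T φ.edgeGain =
      ∑ i, φ.cycleGain (lineCycle i) * φ.expSum π s₁ T (cycleInd i) := by
    simp only [← expSum_const_mul, ← expSum_sum]
    rfl
  have h3 := (abs_le.1 (hB π s₁ T)).2
  have h4 := hB' T
  have h5 : ∑ i, (φ.optGain s₁ - φ.cycleGain (lineCycle i)) * φ.expSum π s₁ T (cycleInd i) =
      T * φ.optGain s₁ - φ.expSum π s₁ T φ.edgeGain := by
    rw [h2, mul_comm]
    conv_rhs => rw [h1, Finset.mul_sum]
    simp only [sub_mul, Finset.sum_sub_distrib]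
  unfold regret
  linarith

/-- The indicator of the states to the right of edge `i` increases by 1 at each rightward crossing,
decreases by 1 at each leftward one and is otherwise unchanged; its increments telescope. -/
theorem IsLineSearch.abs_expSum_pairInd_sub_le (hφ : φ.IsLineSearch)
    (π : Policy (Fin (n + 1)) (Fin 2) (lineAct n)) (s₁ : Fin (n + 1)) (T : ℕ) (i : Fin n) :
    |φ.expSum π s₁ T (pairInd (i.castSucc, 0)) - φ.expSum π s₁ T (pairInd (i.succ, 1))| ≤ 1 := by
  have h := φ.abs_expSum_potential_le π s₁ T (fun s => if s ≤ i.castSucc then 0 else 1)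
    (B := 1) fun s s' => by split_ifs <;> norm_num
  have h1 : φ.expSum π s₁ T (pairInd (i.castSucc, 0)) = φ.expSum π s₁ T (fun e =>
      pairInd (i.succ, 1) e + ((if φ.next e.1 e.2 ≤ i.castSucc then 0 else 1) -
        (if e.1 ≤ i.castSucc then 0 else 1))) := by
    refine φ.expSum_congr π s₁ T fun s a ha => ?_
    rcases lineAct_cases ha with ⟨j, rfl, rfl⟩ | ⟨j, rfl, rfl⟩
    · rw [pairInd_of_ne (p := (i.succ, 1)) (by simp), (hφ j).1]
      rcases lt_trichotomy j i with hj | rfl | hj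
      · rw [pairInd_of_ne (by simpa using hj.ne)]
        have : j.succ ≤ i.castSucc := by
          simp only [Fin.le_def, Fin.val_succ, Fin.val_castSucc]; exact hj
        simp [this, hj.le]
      · simp [pairInd_self, Fin.le_def]
      · rw [pairInd_of_ne (by simpa using hj.ne')]
        have : ¬ j.succ ≤ i.castSucc := by
          simp only [Fin.le_def, Fin.val_succ, Fin.val_castSucc]
          have : (i : ℕ) < j := hj
          omega
        simp [this, not_le.2 hj]
    · rw [pairInd_of_ne (p := (i.castSucc, 0)) (by simp), (hφ j).2]
      rcases lt_trichotomy j i with hj | rfl | hj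
      · rw [pairInd_of_ne (by simpa using hj.ne)]
        have : j.succ ≤ i.castSucc := by
          simp only [Fin.le_def, Fin.val_succ, Fin.val_castSucc]; exact hj
        simp [this, hj.le]
      · simp [pairInd_self, Fin.le_def]
      · rw [pairInd_of_ne (by simpa using hj.ne')]
        have : ¬ j.succ ≤ i.castSucc := by
          simp only [Fin.le_def, Fin.val_succ, Fin.val_castSucc]
          have : (i : ℕ) < j := hj
          omega
        simp [this, not_le.2 hj]
  rw [h1, expSum_add, add_sub_cancel_left]
  exact h

end DMDP

/-! ### The lower bound -/

namespace DMDP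

variable {n : ℕ} {F : Fin (n + 1) → Fin 2 → ExpFamily}
  {φ : DMDP (Fin (n + 1)) (Fin 2) (lineAct n) F}

theorem exists_lineInfo_toReal_eq {g : ℝ} {i : Fin n} (hI : φ.lineInfo g i ≠ ∞) :
    ∃ θ₁ θ₂, (F i.castSucc 0).mean θ₁ = g + φ.cycleGain (lineCycle i) - φ.r i.succ 1 ∧
      (F i.succ 1).mean θ₂ = g + φ.cycleGain (lineCycle i) - φ.r i.castSucc 0 ∧
      (φ.lineInfo g i).toReal = (F i.castSucc 0).div (φ.param i.castSucc 0) θ₁ +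
        (F i.succ 1).div (φ.param i.succ 1) θ₂ := by
  obtain ⟨h1, h2⟩ := ENNReal.add_ne_top.1 hI
  obtain ⟨θ₁, e1⟩ := (F i.castSucc 0).exists_mean_eq_of_kl_ne_top h1
  obtain ⟨θ₂, e2⟩ := (F i.succ 1).exists_mean_eq_of_kl_ne_top h2
  refine ⟨θ₁, θ₂, e1, e2, ?_⟩
  have k1 := (F i.castSucc 0).kl_mean_mean (φ.param i.castSucc 0) θ₁
  have k2 := (F i.succ 1).kl_mean_mean (φ.param i.succ 1) θ₂
  rw [lineInfo, ENNReal.toReal_add h1 h2, ← e1, ← e2]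
  unfold r
  rw [k1, k2, ENNReal.toReal_ofReal (ExpFamily.div_nonneg _ _ _),
    ENNReal.toReal_ofReal (ExpFamily.div_nonneg _ _ _)]

/-- The target mean exceeds the true one by the gap. The family therefore has two different means,
which is what `mean_lt_mean_add` requires. -/
theorem r_ne_of_cycleGain_lt {g : ℝ} {i : Fin n} (hlt : φ.cycleGain (lineCycle i) < g) {θ : ℝ}
    (h : (F i.castSucc 0).mean θ = g + φ.cycleGain (lineCycle i) - φ.r i.succ 1) :
    (F i.castSucc 0).mean (φ.param i.castSucc 0) ≠ (F i.castSucc 0).mean θ := by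
  rw [h, cycleGain_lineCycle]
  rw [cycleGain_lineCycle] at hlt
  change φ.r i.castSucc 0 ≠ _
  intro h
  linarith

theorem lineInfo_toReal_pos {g : ℝ} {i : Fin n} (hlt : φ.cycleGain (lineCycle i) < g)
    (hI : φ.lineInfo g i ≠ ∞) : 0 < (φ.lineInfo g i).toReal := by
  obtain ⟨θ₁, θ₂, h1, -, h⟩ := exists_lineInfo_toReal_eq hI
  have hne := r_ne_of_cycleGain_lt hlt h1
  have p2 := (F i.succ 1).div_nonneg (φ.param i.succ 1) θ₂
  have p1 : 0 < (F i.castSucc 0).div (φ.param i.castSucc 0) θ₁ := by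
    refine lt_of_le_of_ne (ExpFamily.div_nonneg _ _ _) fun h0 => hne ?_
    unfold ExpFamily.mean
    rw [ExpFamily.dist_eq_of_div_eq_zero _ h0.symm]
  linarith

/-- A line search problem, close to the least informative one, in which `Cᵢ` has a gain
above `g`. -/
theorem IsLineSearch.exists_alternative (hφ : φ.IsLineSearch) {g : ℝ} {i : Fin n}
    (hlt : φ.cycleGain (lineCycle i) < g) (hI : φ.lineInfo g i ≠ ∞) {δ : ℝ} (hδ : 0 < δ) :
    ∃ φ' : DMDP (Fin (n + 1)) (Fin 2) (lineAct n) F, φ'.IsLineSearch ∧ φ'.next = φ.next ∧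
      (∀ e : Fin (n + 1) × Fin 2, e ≠ (i.castSucc, 0) → e ≠ (i.succ, 1) →
        φ'.param e.1 e.2 = φ.param e.1 e.2) ∧
      φ.rewardDiv φ' (i.castSucc, 0) + φ.rewardDiv φ' (i.succ, 1) ≤
        (φ.lineInfo g i).toReal + δ ∧
      g < φ'.cycleGain (lineCycle i) := by
  obtain ⟨θ₁, θ₂, h1, h2, h⟩ := exists_lineInfo_toReal_eq hI
  set φ' : DMDP (Fin (n + 1)) (Fin 2) (lineAct n) F :=
    { next := φ.next
      param := fun s a => if (s, a) = (i.castSucc, 0) then θ₁ + δ else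
        if (s, a) = (i.succ, 1) then θ₂ else φ.param s a } with hφ'
  have e1 : φ'.param i.castSucc 0 = θ₁ + δ := by simp [hφ']
  have e2 : φ'.param i.succ 1 = θ₂ := by simp [hφ']
  refine ⟨φ', hφ, rfl, fun e he he' => by simp only [hφ', Prod.mk.eta, he, he', if_false], ?_, ?_⟩
  · unfold rewardDiv
    simp only [e1, e2, h]
    linarith [(F i.castSucc 0).div_add_le (φ.param i.castSucc 0) θ₁ hδ.le]
  -- The means at `θ₁` and `θ₂` add up to `2 * g`; the shift of `θ₁` by `δ` makes the inequality
  -- strict.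
  · have hm := (F i.castSucc 0).mean_lt_mean_add (r_ne_of_cycleGain_lt hlt h1) hδ
    rw [cycleGain_lineCycle] at h1 h2 ⊢
    unfold r at h1 h2 ⊢
    rw [e1, e2]
    linarith

theorem expSum_rewardDiv (φ' : DMDP (Fin (n + 1)) (Fin 2) (lineAct n) F) {i : Fin n}
    (h : ∀ e : Fin (n + 1) × Fin 2, e ≠ (i.castSucc, 0) → e ≠ (i.succ, 1) →
      φ'.param e.1 e.2 = φ.param e.1 e.2)
    (π : Policy (Fin (n + 1)) (Fin 2) (lineAct n)) (s₁ : Fin (n + 1)) (T : ℕ) :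
    φ.expSum π s₁ T (φ.rewardDiv φ') =
      φ.rewardDiv φ' (i.castSucc, 0) * φ.expSum π s₁ T (pairInd (i.castSucc, 0)) +
      φ.rewardDiv φ' (i.succ, 1) * φ.expSum π s₁ T (pairInd (i.succ, 1)) := by
  rw [← expSum_const_mul, ← expSum_const_mul, ← expSum_add]
  congr 1; funext e
  by_cases h0 : e = (i.castSucc, 0)
  · rw [h0, pairInd_self, pairInd_of_ne (by simp)]; ring
  by_cases h1 : e = (i.succ, 1)
  · rw [h1, pairInd_self, pairInd_of_ne (by simp)]; ring
  rw [pairInd_of_ne h0, pairInd_of_ne h1, rewardDiv_eq_zero _ _ _ (h e h0 h1)]; ring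

theorem expSum_cycleInd (φ : DMDP (Fin (n + 1)) (Fin 2) (lineAct n) F)
    (π : Policy (Fin (n + 1)) (Fin 2) (lineAct n)) (s₁ : Fin (n + 1)) (T : ℕ) (i : Fin n) :
    φ.expSum π s₁ T (cycleInd i) = φ.expSum π s₁ T (pairInd (i.castSucc, 0)) +
      φ.expSum π s₁ T (pairInd (i.succ, 1)) := by
  rw [← expSum_add]; rfl

theorem expSum_cycleInd_nonneg (φ : DMDP (Fin (n + 1)) (Fin 2) (lineAct n) F)
    (π : Policy (Fin (n + 1)) (Fin 2) (lineAct n)) (s₁ : Fin (n + 1)) (T : ℕ) (i : Fin n) :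
    0 ≤ φ.expSum π s₁ T (cycleInd i) := by
  have h := φ.expSum_mono π s₁ T (c := fun _ => 0) (d := cycleInd i)
    fun s a _ => cycleInd_nonneg i (s, a)
  rwa [expSum_const, mul_zero] at h

variable {Φ : Set (DMDP (Fin (n + 1)) (Fin 2) (lineAct n) F)}
  {π : Policy (Fin (n + 1)) (Fin 2) (lineAct n)}

theorem IsLineSearch.isLittleO_expSum_cycleInd (hφ : φ.IsLineSearch) (hn : 1 ≤ n) (hmem : φ ∈ Φ)
    (hπ : UniformlyGood Φ π) (s₁ : Fin (n + 1)) {i : Fin n}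
    (hlt : φ.cycleGain (lineCycle i) < φ.optGain s₁) {α : ℝ} (hα : 0 < α) :
    (fun T : ℕ => φ.expSum π s₁ T (cycleInd i)) =o[atTop] (fun T : ℕ => (T : ℝ) ^ α) := by
  have h := hπ φ hmem (hφ.communicating hn) s₁ α hα
  have h1 := h i.castSucc 0 (zero_mem_lineAct i) fun hc => hlt.ne <| by
    rw [← hφ.edgeGain_eq_of_onOptimalCycle s₁ hc, edgeGain_castSucc]
  have h2 := h i.succ 1 (one_mem_lineAct i) fun hc => hlt.ne <| by
    rw [← hφ.edgeGain_eq_of_onOptimalCycle s₁ hc, edgeGain_succ]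
  refine (h1.add h2).congr_left fun T => ?_
  rw [expVisits_eq_expSum_pairInd, expVisits_eq_expSum_pairInd, expSum_cycleInd]

/-- Time off `Cᵢ` is time on the other cycles, all suboptimal. This is meant for the alternative
problem. -/
theorem IsLineSearch.isLittleO_expSum_sub_cycleInd (hφ : φ.IsLineSearch) (hn : 1 ≤ n)
    (hmem : φ ∈ Φ) (hπ : UniformlyGood Φ π) (s₁ : Fin (n + 1)) {i : Fin n}
    (hlt : ∀ j ≠ i, φ.cycleGain (lineCycle j) < φ.optGain s₁) {α : ℝ} (hα : 0 < α) :
    (fun T : ℕ => φ.expSum π s₁ T (fun e => 1 - cycleInd i e)) =o[atTop]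
      (fun T : ℕ => (T : ℝ) ^ α) := by
  have h : (fun T : ℕ => ∑ j ∈ Finset.univ.erase i, φ.expSum π s₁ T (cycleInd j)) =o[atTop]
      (fun T : ℕ => (T : ℝ) ^ α) := IsLittleO.fun_sum fun j hj =>
    hφ.isLittleO_expSum_cycleInd hn hmem hπ s₁ (hlt j (Finset.ne_of_mem_erase hj)) hα
  refine h.congr_left fun T => ?_
  rw [← expSum_sum]
  refine φ.expSum_congr π s₁ T fun s a ha => ?_
  rw [← sum_cycleInd ha, ← Finset.add_sum_erase _ _ (Finset.mem_univ i)]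
  ring

/-- A single slack `x` will serve as the excess information of the alternative, as the exponent in
uniform goodness and as the loss in front of `log T`. -/
theorem exists_pos_lt_div {I c : ℝ} (hI : 0 < I) (hc : c < 1 / I) :
    ∃ x, 0 < x ∧ x < 1 ∧ c < (1 - x) / (I + x) := by
  have h : ContinuousAt (fun x : ℝ => (1 - x) / (I + x)) 0 := by
    refine ContinuousAt.div (by fun_prop) (by fun_prop) (by simpa using hI.ne')
  have h1 : ∀ᶠ x in 𝓝[>] (0 : ℝ), c < (1 - x) / (I + x) :=
    (h.eventually (lt_mem_nhds (by simpa using hc))).filter_mono nhdsWithin_le_nhds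
  have h2 : ∀ᶠ x in 𝓝[>] (0 : ℝ), x < 1 :=
    (gt_mem_nhds one_pos : ∀ᶠ x in 𝓝 (0 : ℝ), x < 1).filter_mono nhdsWithin_le_nhds
  obtain ⟨x, h3, h4, h5⟩ := (h1.and (h2.and self_mem_nhdsWithin)).exists
  exact ⟨x, h5, h4, h3⟩

/-- A suboptimal cycle is used at least `2 log T / I(Cᵢ)` times, asymptotically. -/
theorem IsLineSearch.eventually_mul_log_le (hφ : φ.IsLineSearch) (hn : 1 ≤ n)
    (hΦ : ∀ φ : DMDP (Fin (n + 1)) (Fin 2) (lineAct n) F, φ.IsLineSearch → φ ∈ Φ)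
    (hπ : UniformlyGood Φ π) (s₁ : Fin (n + 1)) {i : Fin n}
    (hlt : φ.cycleGain (lineCycle i) < φ.optGain s₁)
    (hI : φ.lineInfo (φ.optGain s₁) i ≠ ∞) {c : ℝ}
    (hc : c < 1 / (φ.lineInfo (φ.optGain s₁) i).toReal) :
    ∀ᶠ T : ℕ in atTop, 2 * c * Real.log T ≤ φ.expSum π s₁ T (cycleInd i) := by
  set I := (φ.lineInfo (φ.optGain s₁) i).toReal with hIdef
  have hIpos : 0 < I := lineInfo_toReal_pos hlt hI
  obtain ⟨x, hx0, hx1, hcx⟩ := exists_pos_lt_div hIpos hc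
  obtain ⟨φ', hφ', hnext, hparam, hdiv, hgain⟩ := hφ.exists_alternative hlt hI hx0
  have hother : ∀ j ≠ i, φ'.cycleGain (lineCycle j) = φ.cycleGain (lineCycle j) := by
    intro j hj
    rw [cycleGain_lineCycle, cycleGain_lineCycle]
    unfold r
    rw [hparam (j.castSucc, 0) (by simpa using hj) (by simp),
      hparam (j.succ, 1) (by simp) (by simpa using hj)]
  -- The other cycles keep gains at most the old optimum, which `Cᵢ` now exceeds.
  have hopt : ∀ j ≠ i, φ'.cycleGain (lineCycle j) < φ'.optGain s₁ := fun j hj =>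
    ((hother j hj).trans_le (hφ.cycleGain_le_optGain s₁ j)).trans_lt
      (hgain.trans_le (hφ'.cycleGain_le_optGain s₁ i))
  have hlog : Tendsto (fun T : ℕ => Real.log T) atTop atTop :=
    Real.tendsto_log_atTop.comp tendsto_natCast_atTop_atTop
  have hN : Tendsto (fun T : ℕ => φ.expSum π s₁ T (cycleInd i) / T) atTop (𝓝 0) := by
    have := (hφ.isLittleO_expSum_cycleInd hn (hΦ φ hφ) hπ s₁ hlt one_pos).tendsto_div_nhds_zero
    simpa using this
  have hW : Tendsto (fun T : ℕ => φ'.expSum π s₁ T (fun e => 1 - cycleInd i e) / (T : ℝ) ^ x)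
      atTop (𝓝 0) :=
    (hφ'.isLittleO_expSum_sub_cycleInd hn (hΦ φ' hφ') hπ s₁ hopt hx0).tendsto_div_nhds_zero
  have hlim : Tendsto (fun T : ℕ => (1 - x) * (1 - φ.expSum π s₁ T (cycleInd i) / T) -
      φ'.expSum π s₁ T (fun e => 1 - cycleInd i e) / (T : ℝ) ^ x / Real.log T -
      (I + x) / 2 / Real.log T) atTop (𝓝 (1 - x)) := by
    have := (((hN.const_sub 1).const_mul (1 - x)).sub (hW.div_atTop hlog)).sub
      ((tendsto_const_nhds (x := (I + x) / 2)).div_atTop hlog)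
    simpa using this
  have hcx' : c * (I + x) < 1 - x := (lt_div_iff₀ (by linarith)).1 hcx
  filter_upwards [hlim.eventually (lt_mem_nhds hcx'), hlog.eventually_gt_atTop 0,
    eventually_gt_atTop 0] with T hT hlogT hT0
  have hT' : (0 : ℝ) < T := by exact_mod_cast hT0
  -- With this `l`, `exp l / T` equals `T ^ (-x)`, precisely what uniform goodness under `φ'` with
  -- exponent `x` can absorb.
  have hkey := φ.mul_expSum_le φ' π s₁ hnext hT0 (w := fun e => 1 - cycleInd i e)
    (fun e => sub_nonneg.2 (cycleInd_le_one i e))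
    (fun e => sub_le_self _ (cycleInd_nonneg i e)) (l := (1 - x) * Real.log T)
    (mul_nonneg (by linarith) hlogT.le)
  have hw : φ.expSum π s₁ T (fun e => 1 - cycleInd i e) / T =
      1 - φ.expSum π s₁ T (cycleInd i) / T := by
    have : φ.expSum π s₁ T (fun e => 1 - cycleInd i e) = T - φ.expSum π s₁ T (cycleInd i) := by
      have := φ.expSum_add π s₁ T (fun e => 1 - cycleInd i e) (cycleInd i)
      simp only [sub_add_cancel, expSum_const] at this
      linarith
    rw [this, sub_div, div_self hT'.ne']
  have hexp : Real.exp ((1 - x) * Real.log T) *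
      (φ'.expSum π s₁ T (fun e => 1 - cycleInd i e) / T) =
      φ'.expSum π s₁ T (fun e => 1 - cycleInd i e) / (T : ℝ) ^ x := by
    rw [mul_comm (1 - x), ← Real.rpow_def_of_pos hT', Real.rpow_sub hT', Real.rpow_one]
    field_simp
  rw [hw, hexp, expSum_rewardDiv φ' hparam] at hkey
  have habs := abs_le.1 (hφ.abs_expSum_pairInd_sub_le π s₁ T i)
  have hsum := φ.expSum_cycleInd π s₁ T i
  set N := φ.expSum π s₁ T (cycleInd i)
  set W := φ'.expSum π s₁ T (fun e => 1 - cycleInd i e) / (T : ℝ) ^ x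
  have hN0 : 0 ≤ N := φ.expSum_cycleInd_nonneg π s₁ T i
  have d1 := φ.rewardDiv_nonneg φ' (i.castSucc, 0)
  have d2 := φ.rewardDiv_nonneg φ' (i.succ, 1)
  -- The visits to the two pairs sum to `N` and differ by at most 1, so each is at most `N / 2 + 1 /
  -- 2`.
  have hbound : φ.rewardDiv φ' (i.castSucc, 0) * φ.expSum π s₁ T (pairInd (i.castSucc, 0)) +
      φ.rewardDiv φ' (i.succ, 1) * φ.expSum π s₁ T (pairInd (i.succ, 1)) ≤
      (I + x) * (N / 2 + 1 / 2) := by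
    have b1 := mul_le_mul_of_nonneg_left
      (show φ.expSum π s₁ T (pairInd (i.castSucc, 0)) ≤ N / 2 + 1 / 2 by linarith) d1
    have b2 := mul_le_mul_of_nonneg_left
      (show φ.expSum π s₁ T (pairInd (i.succ, 1)) ≤ N / 2 + 1 / 2 by linarith) d2
    have b3 := mul_le_mul_of_nonneg_right hdiv (show 0 ≤ N / 2 + 1 / 2 by linarith)
    linarith
  have h1 : c * (I + x) * Real.log T < (I + x) * (N / 2) := by
    have h2 := mul_lt_mul_of_pos_right hT hlogT
    rw [sub_mul, sub_mul, div_mul_cancel₀ _ hlogT.ne', div_mul_cancel₀ _ hlogT.ne'] at h2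
    linarith
  have h3 : c * Real.log T < N / 2 := by
    refine lt_of_mul_lt_mul_left (a := I + x) ?_ (by linarith)
    linarith
  linarith

/-- In `ℝ≥0∞` both `0 / 0` and `x / ∞` with finite `x` are 0, the intended reading of degenerate
summands; with a positive gap the information is positive. -/
theorem IsLineSearch.div_lineInfo_ne_top (hφ : φ.IsLineSearch) (s₁ : Fin (n + 1)) (i : Fin n) :
    ENNReal.ofReal (2 * (φ.optGain s₁ - φ.cycleGain (lineCycle i))) /
      φ.lineInfo (φ.optGain s₁) i ≠ ∞ := by
  rcases (hφ.cycleGain_le_optGain s₁ i).eq_or_lt with h | h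
  · simp [h]
  by_cases hI : φ.lineInfo (φ.optGain s₁) i = ∞
  · simp [hI]
  · refine ENNReal.div_ne_top ENNReal.ofReal_ne_top fun h0 => ?_
    have := lineInfo_toReal_pos h hI
    simp [h0] at this

theorem IsLineSearch.eventually_mul_log_le_gap (hφ : φ.IsLineSearch) (hn : 1 ≤ n)
    (hΦ : ∀ φ : DMDP (Fin (n + 1)) (Fin 2) (lineAct n) F, φ.IsLineSearch → φ ∈ Φ)
    (hπ : UniformlyGood Φ π) (s₁ : Fin (n + 1)) (i : Fin n) {a : ℝ}
    (ha : a < (ENNReal.ofReal (2 * (φ.optGain s₁ - φ.cycleGain (lineCycle i))) /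
      φ.lineInfo (φ.optGain s₁) i).toReal) :
    ∀ᶠ T : ℕ in atTop, a * Real.log T ≤
      (φ.optGain s₁ - φ.cycleGain (lineCycle i)) * φ.expSum π s₁ T (cycleInd i) := by
  have hle := hφ.cycleGain_le_optGain s₁ i
  -- Negative `a` does occur: a degenerate summand is 0, and a little is subtracted from it in the
  -- final step.
  rcases lt_or_ge a 0 with ha0 | ha0
  · refine Eventually.of_forall fun T => ?_
    exact (mul_nonpos_of_nonpos_of_nonneg ha0.le (Real.log_natCast_nonneg T)).trans
      (mul_nonneg (sub_nonneg.2 hle) (φ.expSum_cycleInd_nonneg π s₁ T i))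
  rcases hle.eq_or_lt with h | h
  · simp [h] at ha
    linarith
  by_cases hI : φ.lineInfo (φ.optGain s₁) i = ∞
  · simp [hI] at ha
    linarith
  have hgap : 0 < φ.optGain s₁ - φ.cycleGain (lineCycle i) := sub_pos.2 h
  rw [ENNReal.toReal_div, ENNReal.toReal_ofReal (by linarith),
    lt_div_iff₀ (lineInfo_toReal_pos h hI)] at ha
  have hc : a / (2 * (φ.optGain s₁ - φ.cycleGain (lineCycle i))) <
      1 / (φ.lineInfo (φ.optGain s₁) i).toReal := by
    rw [div_lt_div_iff₀ (by linarith) (lineInfo_toReal_pos h hI)]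
    linarith
  filter_upwards [hφ.eventually_mul_log_le hn hΦ hπ s₁ h hI hc] with T hT
  refine le_trans (le_of_eq ?_) (mul_le_mul_of_nonneg_left hT hgap.le)
  field_simp

end DMDP

theorem corollary1 (n : ℕ) (hn : 1 ≤ n) (F : Fin (n + 1) → Fin 2 → ExpFamily)
    (Φ : Set (DMDP (Fin (n + 1)) (Fin 2) (lineAct n) F))
    (hΦ : ∀ φ : DMDP (Fin (n + 1)) (Fin 2) (lineAct n) F, φ.IsLineSearch → φ ∈ Φ)
    (π : Policy (Fin (n + 1)) (Fin 2) (lineAct n)) (hπ : UniformlyGood Φ π)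
    (φ : DMDP (Fin (n + 1)) (Fin 2) (lineAct n) F) (hφ : φ.IsLineSearch) (s₁ : Fin (n + 1)) :
    ((∑ i : Fin n, ENNReal.ofReal (2 * (φ.optGain s₁ - φ.cycleGain (DMDP.lineCycle i))) /
        φ.lineInfo (φ.optGain s₁) i : ℝ≥0∞) : EReal) ≤
      liminf (fun T : ℕ => ((φ.regret π s₁ T / Real.log T : ℝ) : EReal)) atTop := by
  have hne := hφ.div_lineInfo_ne_top s₁
  rw [← EReal.coe_ennreal_toReal (ENNReal.sum_ne_top.2 fun i _ => hne i),
    ENNReal.toReal_sum fun i _ => hne i]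
  refine EReal.ge_of_forall_gt_iff_ge.1 fun y hy => ?_
  rw [EReal.coe_lt_coe_iff] at hy
  set a : Fin n → ℝ := fun i => (ENNReal.ofReal
    (2 * (φ.optGain s₁ - φ.cycleGain (DMDP.lineCycle i))) / φ.lineInfo (φ.optGain s₁) i).toReal
  -- One `ε` is spent on each of the `n` cycles, and the last one absorbs the constant `B` once `log
  -- T ≥ B / ε`.
  obtain ⟨ε, hε, hεy⟩ : ∃ ε, 0 < ε ∧ y + (n + 1) * ε = ∑ i, a i :=
    ⟨(∑ i, a i - y) / (n + 1), div_pos (sub_pos.2 hy) (by positivity), by field_simp; ring⟩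
  obtain ⟨B, hB⟩ := hφ.exists_le_regret hn s₁
  have hlog : Tendsto (fun T : ℕ => Real.log T) atTop atTop :=
    Real.tendsto_log_atTop.comp tendsto_natCast_atTop_atTop
  have hall : ∀ᶠ T : ℕ in atTop, ∀ i, (a i - ε) * Real.log T ≤
      (φ.optGain s₁ - φ.cycleGain (DMDP.lineCycle i)) *
        φ.expSum π s₁ T (DMDP.cycleInd i) :=
    eventually_all.2 fun i => hφ.eventually_mul_log_le_gap hn hΦ hπ s₁ i (sub_lt_self _ hε)
  refine le_liminf_of_le (by isBoundedDefault) ?_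
  filter_upwards [hall, hlog.eventually_gt_atTop 0, hlog.eventually_ge_atTop (B / ε)]
    with T hT hlogT hlogB
  rw [EReal.coe_le_coe_iff, le_div_iff₀ hlogT]
  have h1 := Finset.sum_le_sum fun i (_ : i ∈ Finset.univ) => hT i
  rw [← Finset.sum_mul, Finset.sum_sub_distrib, Finset.sum_const, Finset.card_univ,
    Fintype.card_fin, nsmul_eq_mul, ← hεy] at h1
  have h2 := hB π T
  have h3 := (div_le_iff₀ hε).1 hlogB
  linarith
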